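/- Let $\mathbf X\in\mathbb R^{n\times p}$ be a fixed design matrix with rows $\mathbf x_i'$, columns $\mathbf x_{(j)}$ and entries $x_{ij}$, let $\beta^\star\in\mathbb R^p$, $\mathcal A=\{j:\beta^\star_j\ne0\}$, $s=|\mathcal A|$, and let $\psi(t)=\log(1+e^t)$. Assume (A2) $y_1,\dots,y_n$ are independent, and $y_i$ is Bernoulli with $\Pr(y_i=1)=e^{\mathbf x_i'\beta^\star}/(1+e^{\mathbf x_i'\beta^\star})$. Put $\ell_n(\beta)=\frac1n\sum_i\{-y_i\mathbf x_i'\beta+\psi(\mathbf x_i'\beta)\}$, $\Sigma(\beta)=\operatorname{diag}\{\psi''(\mathbf x_1'\beta),\dots,\psi''(\mathbf x_n'\beta)\}$, so that $\nabla^2\ell_n(\beta)=\frac1n\mathbf X'\Sigma(\beta)\mathbf X$, and, for $\lambda_{\mathrm{lasso}}>0$, $$\hat\beta^{\mathrm{oracle}}=\arg\min_{\beta:\,\beta_{\mathcal A^c}=0}\ell_n(\beta),\qquad \hat\beta^{\mathrm{lasso}}\in\arg\min_{\beta}\ \ell_n(\beta)+\lambda_{\mathrm{lasso}}\|\beta\|_{\ell_1}.$$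 Let $P_\lambda$ be a folded concave penalty with constants $a_1,a_2>0$ and $a>a_2$: on $[0,\infty)$ it is nondecreasing and concave with $P_\lambda(0)=0$; it is differentiable on $(0,\infty)$ with $P'_\lambda(0):=P'_\lambda(0+)$ (finite) $\ge a_1\lambda$; $P'_\lambda(t)\ge a_1\lambda$ for $t\in(0,a_2\lambda]$; and $P'_\lambda(t)=0$ for $t\ge a\lambda$. Let $a_0=\min\{1,a_2\}$. The LLA algorithm started at $\hat\beta^{(0)}$ computes, for $k=1,2,\dots$, $$\hat\beta^{(k)}\in\arg\min_\beta\ \ell_n(\beta)+\sum_jP'_\lambda(|\hat\beta^{(k-1)}_j|)\,|\beta_j|.$$ Write $M=\max_j n^{-1}\|\mathbf x_{(j)}\|_{\ell_2}^2$, $m=\max_{i,j}|x_{ij}|$, $\|\mathbf U\|_{\ell_\infty}=\max_i\sum_j|u_{ij}|$, $\|\beta^\star_{\mathcal A}\|_{\min}=\min_{j\in\mathcal A}|\beta^\star_j|$, and $$Q_1=\max_j\lambda_{\max}\Bigl(\tfrac1n\mathbf X_{\mathcal A}'\operatorname{diag}\{|\mathbf x_{(j)}|\}\mathbf X_{\mathcal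 A}\Bigr),\qquad Q_2=\Bigl\|\bigl(\tfrac1n\mathbf X_{\mathcal A}'\Sigma(\beta^\star)\mathbf X_{\mathcal A}\bigr)^{-1}\Bigr\|_{\ell_\infty},\qquad Q_3=\bigl\|\mathbf X_{\mathcal A^c}'\Sigma(\beta^\star)\mathbf X_{\mathcal A}(\mathbf X_{\mathcal A}'\Sigma(\beta^\star)\mathbf X_{\mathcal A})^{-1}\bigr\|_{\ell_\infty}.$$ Assume further (A0) $\|\beta^\star_{\mathcal A}\|_{\min}>(a+1)\lambda$; (C2) $\displaystyle\kappa_{\mathrm{logit}}=\min_{\mathbf u\ne0:\,\|\mathbf u_{\mathcal A^c}\|_{\ell_1}\le3\|\mathbf u_{\mathcal A}\|_{\ell_1}}\frac{\mathbf u'\nabla^2\ell_n(\beta^\star)\mathbf u}{\mathbf u'\mathbf u}\in(0,\infty)$ (in particular $s\ge1$); and that $\lambda_{\mathrm{lasso}}\le\dfrac{\kappa_{\mathrm{logit}}}{20ms}$ and $\lambda\ge\dfrac{5s^{1/2}\lambda_{\mathrm{lasso}}}{a_0\kappa_{\mathrm{logit}}}$. Then, with probability at least $$1-2p\exp\Bigl(-\frac{n}{2M}\lambda_{\mathrm{lasso}}^2\Bigr)-\delta_1^{\mathrm{logit}}-\delta_2^{\mathrm{logit}},$$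 $\hat\beta^{\mathrm{oracle}}$ exists and is unique, $\hat\beta^{\mathrm{lasso}}$ exists, and the LLA algorithm initialized by (any) $\hat\beta^{\mathrm{lasso}}$ is well defined and converges to $\hat\beta^{\mathrm{oracle}}$ after two iterations: the first iteration finds $\hat\beta^{\mathrm{oracle}}$ and the second, as well as every later one, returns it again, i.e. $\hat\beta^{(k)}=\hat\beta^{\mathrm{oracle}}$ for all $k\ge1$. Here $$\delta_1^{\mathrm{logit}}=2s\exp\Bigl(-\frac nM\min\Bigl\{\frac{2}{Q_1^2Q_2^4s^2},\frac{a_1^2\lambda^2}{2(1+2Q_3)^2}\Bigr\}\Bigr)+2(p-s)\exp\Bigl(-\frac{a_1^2n\lambda^2}{2M}\Bigr),$$ $$\delta_2^{\mathrm{logit}}=2s\exp\Bigl(-\frac{n}{MQ_2^2}\min\Bigl\{\frac{2}{Q_1^2Q_2^2s^2},\frac12\bigl(\|\beta^\star_{\mathcal A}\|_{\min}-a\lambda\bigr)^2\Bigr\}\Bigr).$$ -/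

import Mathlib

open MeasureTheory ProbabilityTheory Filter Topology Matrix

noncomputable section

namespace FoldedConcave

/-! ### Folded concave penalties -/

/-- The derivative `P'` of a penalty `P` on `[0, ∞)`, with the convention `P'(0) := P'(0+)`. -/
def penaltyDeriv (P : ℝ → ℝ) (t : ℝ) : ℝ :=
  if t = 0 then limUnder (𝓝[>] (0 : ℝ)) (deriv P) else deriv P t

/-- `P` (seen as a function on `[0, ∞)`) is a general folded concave penalty `P_λ` with
regularization parameter `lam` and constants `a₁, a₂ > 0` and `a > a₂`. -/
structure IsFoldedConcave (P : ℝ → ℝ) (lam a₁ a₂ a : ℝ) : Prop where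
  a₁_pos : 0 < a₁
  a₂_pos : 0 < a₂
  a₂_lt : a₂ < a
  monotone : MonotoneOn P (Set.Ici 0)
  concave : ConcaveOn ℝ (Set.Ici 0) P
  zero : P 0 = 0
  differentiable : ∀ t, 0 < t → DifferentiableAt ℝ P t
  /-- The right limit `P'(0+)` exists and is at least `a₁ λ`. -/
  deriv_zero : ∃ d, Tendsto (deriv P) (𝓝[>] (0 : ℝ)) (𝓝 d) ∧ a₁ * lam ≤ d
  deriv_small : ∀ t, 0 < t → t ≤ a₂ * lam → a₁ * lam ≤ deriv P t
  deriv_large : ∀ t, a * lam ≤ t → deriv P t = 0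

/-! ### Norms and eigenvalues -/

/-- The largest eigenvalue of a symmetric real matrix. -/
def lambdaMax {ι : Type*} [Fintype ι] [DecidableEq ι] (B : Matrix ι ι ℝ) : ℝ :=
  sSup (spectrum ℝ B)

/-- The matrix norm `‖B‖_{ℓ∞} = max_i ∑_j |b_ij|` (zero if there are no rows). -/
def linftyNorm {ι κ : Type*} [Fintype κ] (B : Matrix ι κ ℝ) : ℝ :=
  ⨆ i, ∑ j, |B i j|

/-! ### Logistic regression with a fixed design -/

variable {n p : ℕ}

/-- `ψ(t) = log (1 + exp t)`. -/
def psi (t : ℝ) : ℝ := Real.log (1 + Real.exp t)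

/-- `exp t / (1 + exp t)`, as an element of the unit interval. -/
def successProb (t : ℝ) : unitInterval :=
  ⟨Real.exp t / (1 + Real.exp t), by positivity,
    (div_le_one (by positivity)).2 (by linarith [Real.exp_pos t])⟩

/-- The loss `ℓ_n(b) = n⁻¹ ∑_i (- y_i x_i'b + ψ(x_i'b))`; the rows of `X` are the `x_i`. -/
def loss (X : Matrix (Fin n) (Fin p) ℝ) (y : Fin n → ℝ) (b : Fin p → ℝ) : ℝ :=
  (1 / (n : ℝ)) * ∑ i, (-(y i * (X *ᵥ b) i) + psi ((X *ᵥ b) i))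

/-- The logistic regression model: given the design, `y_1, …, y_n` are independent and `y_i` takes
the value `1` with probability `exp(x_i'β⋆) / (1 + exp(x_i'β⋆))` and `0` otherwise. -/
structure IsLogisticModel {Ω : Type*} [MeasurableSpace Ω] (μ : Measure Ω)
    (X : Matrix (Fin n) (Fin p) ℝ) (βs : Fin p → ℝ) (y : Fin n → Ω → ℝ) : Prop where
  indep : iIndepFun y μ
  law : ∀ i, HasLaw (y i) (bernoulliMeasure (1 : ℝ) 0 (successProb ((X *ᵥ βs) i))) μ

/-- The true support `A = {j | β⋆_j ≠ 0}`. -/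
def supp (βs : Fin p → ℝ) : Finset (Fin p) := {j | βs j ≠ 0}

/-- The submatrix `X_S` of the columns with index in `S`. -/
def cols (X : Matrix (Fin n) (Fin p) ℝ) (S : Finset (Fin p)) : Matrix (Fin n) S ℝ :=
  X.submatrix id Subtype.val

/-- The minimal signal strength `‖β⋆_A‖_min`. -/
def minSignal (βs : Fin p → ℝ) : ℝ := ⨅ j : supp βs, |βs j|

/-- `Σ(b) = diag (ψ''(x_1'b), …, ψ''(x_n'b))`. -/
def Sig (X : Matrix (Fin n) (Fin p) ℝ) (b : Fin p → ℝ) : Matrix (Fin n) (Fin n) ℝ :=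
  Matrix.diagonal fun i => deriv (deriv psi) ((X *ᵥ b) i)

/-- The Hessian `∇²ℓ_n(b) = n⁻¹ X' Σ(b) X` (see `deriv_deriv_loss`; it does not depend on `y`). -/
def hess (X : Matrix (Fin n) (Fin p) ℝ) (b : Fin p → ℝ) : Matrix (Fin p) (Fin p) ℝ :=
  (1 / (n : ℝ)) • (Xᵀ * Sig X b * X)

lemma contDiff_psi : ContDiff ℝ 2 psi := by
  unfold psi
  refine ContDiff.log (by fun_prop) fun t => ?_
  positivity

/-- `hess` is the Hessian matrix of the loss: its quadratic form is the second derivative of the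
loss along lines, whatever the responses. -/
lemma deriv_deriv_loss (X : Matrix (Fin n) (Fin p) ℝ) (y : Fin n → ℝ) (b u : Fin p → ℝ) :
    deriv (deriv fun t : ℝ => loss X y (b + t • u)) 0 = u ⬝ᵥ (hess X b *ᵥ u) := by
  have h1 : Differentiable ℝ psi := contDiff_psi.differentiable (by norm_num)
  have h2 : Differentiable ℝ (deriv psi) :=
    ((contDiff_succ_iff_deriv (n := 1)).1 contDiff_psi).2.2.differentiable (by norm_num)
  have hl : ∀ (i : Fin n) (t : ℝ),
      HasDerivAt (fun t : ℝ => (X *ᵥ b) i + t * (X *ᵥ u) i) ((X *ᵥ u) i) t := fun i t => by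
    simpa using ((hasDerivAt_id t).mul_const ((X *ᵥ u) i)).const_add ((X *ᵥ b) i)
  have e0 : (fun t : ℝ => loss X y (b + t • u)) = fun t => (1 / (n : ℝ)) * ∑ i,
      (-(y i * ((X *ᵥ b) i + t * (X *ᵥ u) i)) + psi ((X *ᵥ b) i + t * (X *ᵥ u) i)) := by
    funext t
    simp [loss, Matrix.mulVec_add, Matrix.mulVec_smul]
  have e1 : deriv (fun t : ℝ => loss X y (b + t • u)) = fun t => (1 / (n : ℝ)) * ∑ i,
      (-(y i * (X *ᵥ u) i) + deriv psi ((X *ᵥ b) i + t * (X *ᵥ u) i) * (X *ᵥ u) i) := by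
    rw [e0]
    funext t
    refine (HasDerivAt.const_mul _ (HasDerivAt.fun_sum fun i _ => ?_)).deriv
    exact ((hl i t).const_mul (y i)).neg.add ((h1 _).hasDerivAt.comp t (hl i t))
  rw [e1]
  have e2 : HasDerivAt (fun t : ℝ => (1 / (n : ℝ)) * ∑ i,
      (-(y i * (X *ᵥ u) i) + deriv psi ((X *ᵥ b) i + t * (X *ᵥ u) i) * (X *ᵥ u) i))
      ((1 / (n : ℝ)) * ∑ i, (deriv (deriv psi) ((X *ᵥ b) i + 0 * (X *ᵥ u) i) * (X *ᵥ u) i)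
        * (X *ᵥ u) i) 0 := by
    refine HasDerivAt.const_mul _ (HasDerivAt.fun_sum fun i _ => ?_)
    exact (((h2 _).hasDerivAt.comp (0 : ℝ) (hl i 0)).mul_const _).const_add _
  rw [e2.deriv, hess, Matrix.smul_mulVec, dotProduct_smul, smul_eq_mul, Matrix.mul_assoc,
    ← Matrix.mulVec_mulVec, Matrix.dotProduct_mulVec, Matrix.vecMul_transpose,
    ← Matrix.mulVec_mulVec]
  congr 1
  simp only [dotProduct, Sig, Matrix.mulVec_diagonal]
  refine Finset.sum_congr rfl fun i _ => ?_
  simp only [zero_mul, add_zero]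
  ring

/-- `M = max_j n⁻¹ ‖x_(j)‖²`, the maximum over the columns of `X`. -/
def colM (X : Matrix (Fin n) (Fin p) ℝ) : ℝ := ⨆ j, (1 / (n : ℝ)) * ∑ i, X i j ^ 2

/-- `m = max_{(i,j)} |x_ij|`. -/
def maxEntry (X : Matrix (Fin n) (Fin p) ℝ) : ℝ := ⨆ ij : Fin n × Fin p, |X ij.1 ij.2|

/-- `Q₁ = max_j λ_max (n⁻¹ X_A' diag(|x_(j)|) X_A)`. -/
def Q1 (X : Matrix (Fin n) (Fin p) ℝ) (βs : Fin p → ℝ) : ℝ :=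
  ⨆ j : Fin p, lambdaMax ((1 / (n : ℝ)) •
    ((cols X (supp βs))ᵀ * Matrix.diagonal (fun i => |X i j|) * cols X (supp βs)))

/-- `Q₂ = ‖(n⁻¹ X_A' Σ(β⋆) X_A)⁻¹‖_{ℓ∞}`. -/
def Q2 (X : Matrix (Fin n) (Fin p) ℝ) (βs : Fin p → ℝ) : ℝ :=
  linftyNorm (((1 / (n : ℝ)) • ((cols X (supp βs))ᵀ * Sig X βs * cols X (supp βs)))⁻¹)

/-- `Q₃ = ‖X_{Aᶜ}' Σ(β⋆) X_A (X_A' Σ(β⋆) X_A)⁻¹‖_{ℓ∞}`. -/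
def Q3 (X : Matrix (Fin n) (Fin p) ℝ) (βs : Fin p → ℝ) : ℝ :=
  linftyNorm ((cols X (supp βs)ᶜ)ᵀ * Sig X βs * cols X (supp βs) *
    ((cols X (supp βs))ᵀ * Sig X βs * cols X (supp βs))⁻¹)

/-- The restricted eigenvalue `κ_logit`: the minimum of `u'∇²ℓ_n(β⋆)u / u'u` over the `u ≠ 0` with
`‖u_{Aᶜ}‖₁ ≤ 3 ‖u_A‖₁`. (If `A` is empty there is no such `u`, and the value is `0`.) -/
def kappaLogit (X : Matrix (Fin n) (Fin p) ℝ) (βs : Fin p → ℝ) : ℝ :=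
  sInf {r | ∃ u : Fin p → ℝ, u ≠ 0 ∧
    ∑ j ∈ (supp βs)ᶜ, |u j| ≤ 3 * ∑ j ∈ supp βs, |u j| ∧
    r = (u ⬝ᵥ (hess X βs *ᵥ u)) / (u ⬝ᵥ u)}

/-- `δ₁^logit`. -/
def delta1 (X : Matrix (Fin n) (Fin p) ℝ) (βs : Fin p → ℝ) (lam a₁ : ℝ) : ℝ :=
  2 * ((supp βs).card : ℝ) * Real.exp (-((n : ℝ) / colM X *
      min (2 / (Q1 X βs ^ 2 * Q2 X βs ^ 4 * ((supp βs).card : ℝ) ^ 2))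
        (a₁ ^ 2 * lam ^ 2 / (2 * (1 + 2 * Q3 X βs) ^ 2)))) +
    2 * ((p : ℝ) - (supp βs).card) * Real.exp (-(a₁ ^ 2 * n * lam ^ 2 / (2 * colM X)))

/-- `δ₂^logit`. -/
def delta2 (X : Matrix (Fin n) (Fin p) ℝ) (βs : Fin p → ℝ) (lam a : ℝ) : ℝ :=
  2 * ((supp βs).card : ℝ) * Real.exp (-((n : ℝ) / (colM X * Q2 X βs ^ 2) *
      min (2 / (Q1 X βs ^ 2 * Q2 X βs ^ 2 * ((supp βs).card : ℝ) ^ 2))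
        (1 / 2 * (minSignal βs - a * lam) ^ 2)))

/-! ### The estimators and the local linear approximation algorithm -/

/-- `b` is an oracle estimator: it minimizes the loss among the vectors that vanish off `A`. -/
def IsOracle (X : Matrix (Fin n) (Fin p) ℝ) (y : Fin n → ℝ) (βs b : Fin p → ℝ) : Prop :=
  b ∈ {c : Fin p → ℝ | ∀ j ∉ supp βs, c j = 0} ∧
    IsMinOn (loss X y) {c : Fin p → ℝ | ∀ j ∉ supp βs, c j = 0} b

/-- `b` minimizes the weighted `ℓ₁`-penalized loss `ℓ_n(b) + ∑_j w_j |b_j|`. -/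
def IsWeightedLasso (X : Matrix (Fin n) (Fin p) ℝ) (y : Fin n → ℝ) (w b : Fin p → ℝ) : Prop :=
  IsMinOn (fun c : Fin p → ℝ => loss X y c + ∑ j, w j * |c j|) Set.univ b

/-- `b` is an `ℓ₁`-penalized maximum likelihood estimator. -/
def IsLasso (X : Matrix (Fin n) (Fin p) ℝ) (y : Fin n → ℝ) (lamLasso : ℝ) (b : Fin p → ℝ) : Prop :=
  IsMinOn (fun c : Fin p → ℝ => loss X y c + lamLasso * ∑ j, |c j|) Set.univ b

/-- `B 0, B 1, B 2, …` is a run of the LLA algorithm for the penalty `P`, initialized by `B 0`. -/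
def IsLLARun (X : Matrix (Fin n) (Fin p) ℝ) (y : Fin n → ℝ) (P : ℝ → ℝ)
    (B : ℕ → Fin p → ℝ) : Prop :=
  ∀ k, IsWeightedLasso X y (fun j => penaltyDeriv P |B k j|) (B (k + 1))

/-- For the data `(X, y)`: the oracle estimator exists and is unique, the `ℓ₁`-penalized estimator
exists, and the LLA algorithm, initialized by any such estimator, can be run and always converges
to the oracle estimator after two iterations: the first iteration finds it, and the second one and
all later ones return it again. -/
def LLAReachesOracle (X : Matrix (Fin n) (Fin p) ℝ) (βs : Fin p → ℝ) (P : ℝ → ℝ) (lamLasso : ℝ)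
    (y : Fin n → ℝ) : Prop :=
  ∃ bo : Fin p → ℝ, (∀ b, IsOracle X y βs b ↔ b = bo) ∧
    (∃ b₀, IsLasso X y lamLasso b₀) ∧
    ∀ b₀, IsLasso X y lamLasso b₀ →
      (∃ B, IsLLARun X y P B ∧ B 0 = b₀) ∧
      ∀ B, IsLLARun X y P B → B 0 = b₀ → ∀ k, 1 ≤ k → B k = bo

end FoldedConcave

end

namespace FoldedConcave

/-! All randomness enters through the gradient of the loss at `βs`. If its coordinates are small
enough, the conclusion is deterministic.

(1) The lasso basic inequality puts the error `b - βs` in the restricted eigenvalue cone. The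
Bregman divergence of the loss is at least a third of the Hessian form while the linear predictors
move by at most 1 (`breg_ge`), and convexity lets a long error be shrunk into that range. The `ℓ₂`
error is thus at most `5 √s lamLasso / κ`, hence at most `min 1 a₂ * lam` (`abs_sub_le_of_isLasso`).

(2) Let `g` bound the gradient at `βs` on the support. The score equation on the support is a
fixed-point equation for a contraction of the sup-norm ball of radius `2 Q2 g`. Its solution `bo`
keeps large entries on the support and has gradient below `a₁ lam` off it (`exists_oracle`).

(3) By (1), the weights of the first LLA step vanish on the support and are at least `a₁ lam` off
it. Then `bo` satisfies the optimality conditions strictly off the support and is the unique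
minimizer (`isWeightedLasso_iff`). The weights computed from `bo` have the same two properties, so
every later step returns it.

Each gradient coordinate is a sum of independent bounded centred terms, sub-Gaussian with parameter
at most `M / (4n)`. A union bound over the four ways of failing gives the stated probability. -/

/-! ### Scalar estimates for the logistic function. -/

lemma exp_div_one_add_exp (t : ℝ) : Real.exp t / (1 + Real.exp t) = Real.sigmoid t := by
  rw [Real.sigmoid_def, Real.exp_neg]
  have := Real.exp_pos t
  field_simp
  ring

lemma hasDerivAt_psi (t : ℝ) : HasDerivAt psi (Real.sigmoid t) t := by
  rw [← exp_div_one_add_exp]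
  exact ((Real.hasDerivAt_exp t).const_add 1).log (by positivity)

lemma deriv_psi : deriv psi = Real.sigmoid := funext fun t => (hasDerivAt_psi t).deriv

/-- The second derivative of `psi`. -/
noncomputable def psiTwo (t : ℝ) : ℝ := Real.sigmoid t * (1 - Real.sigmoid t)

lemma deriv_deriv_psi : deriv (deriv psi) = psiTwo := by
  rw [deriv_psi, Real.deriv_sigmoid]
  rfl

lemma hasDerivAt_sigmoid_psiTwo (t : ℝ) : HasDerivAt Real.sigmoid (psiTwo t) t :=
  Real.hasDerivAt_sigmoid t

lemma psiTwo_pos (t : ℝ) : 0 < psiTwo t :=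
  mul_pos (Real.sigmoid_pos t) (sub_pos.2 (Real.sigmoid_lt_one t))

lemma psiTwo_eq (t : ℝ) : psiTwo t = (Real.exp t + 2 + Real.exp (-t))⁻¹ := by
  rw [psiTwo, ← exp_div_one_add_exp, Real.exp_neg]
  have := Real.exp_pos t
  field_simp
  ring

lemma abs_sigmoid_sub_le (s t : ℝ) : |Real.sigmoid s - Real.sigmoid t| ≤ 1 / 4 * |s - t| := by
  have h := Convex.norm_image_sub_le_of_norm_hasDerivWithin_le (f := Real.sigmoid) (f' := psiTwo)
    (s := Set.univ) (x := t) (y := s) (C := 1 / 4)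
    (fun x _ => (hasDerivAt_sigmoid_psiTwo x).hasDerivWithinAt) (fun x _ => ?_) convex_univ
    (Set.mem_univ _) (Set.mem_univ _)
  · simpa [Real.norm_eq_abs] using h
  · rw [Real.norm_of_nonneg (psiTwo_pos x).le, psiTwo]
    nlinarith [sq_nonneg (Real.sigmoid x - 1 / 2)]

lemma abs_psiTwo_sub_le (s t : ℝ) : |psiTwo s - psiTwo t| ≤ 1 / 4 * |s - t| := by
  have e : psiTwo s - psiTwo t
      = (Real.sigmoid s - Real.sigmoid t) * (1 - Real.sigmoid s - Real.sigmoid t) := by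
    simp only [psiTwo]; ring
  have h1 : |1 - Real.sigmoid s - Real.sigmoid t| ≤ 1 := by
    rw [abs_le]
    constructor <;> linarith [Real.sigmoid_pos s, Real.sigmoid_pos t, Real.sigmoid_lt_one s,
      Real.sigmoid_lt_one t]
  rw [e, abs_mul]
  exact (mul_le_of_le_one_right (abs_nonneg _) h1).trans (abs_sigmoid_sub_le s t)

/-- The second-order remainder of the mean function of the logistic model. -/
noncomputable def meanRem (t d : ℝ) : ℝ := Real.sigmoid (t + d) - Real.sigmoid t - psiTwo t * d

lemma meanRem_zero (t : ℝ) : meanRem t 0 = 0 := by simp [meanRem]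

/-- The derivative of the remainder at `x` is `psiTwo (t + x) - psiTwo t`, at most `|x| / 4`. The
factor `|d| + |e|` is what makes the later fixed-point map contract on small balls. -/
lemma abs_meanRem_sub_le (t d e : ℝ) :
    |meanRem t d - meanRem t e| ≤ 1 / 4 * ((|d| + |e|) * |d - e|) := by
  have h := Convex.norm_image_sub_le_of_norm_hasDerivWithin_le (f := meanRem t)
    (f' := fun x => psiTwo (t + x) - psiTwo t)
    (s := Set.uIcc e d) (x := e) (y := d) (C := 1 / 4 * (|d| + |e|))
    (fun x _ => ?_) (fun x hx => ?_) (convex_uIcc _ _)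
    Set.left_mem_uIcc Set.right_mem_uIcc
  · simpa [Real.norm_eq_abs, mul_assoc] using h
  · refine HasDerivAt.hasDerivWithinAt ?_
    have h1 : HasDerivAt (fun d => Real.sigmoid (t + d)) (psiTwo (t + x)) x :=
      (hasDerivAt_sigmoid_psiTwo (t + x)).comp_const_add t x
    have h2 : HasDerivAt (fun d => psiTwo t * d) (psiTwo t) x := by
      simpa using (hasDerivAt_id x).const_mul (psiTwo t)
    exact (h1.sub_const _).sub h2
  · rw [Real.norm_eq_abs]
    refine (abs_psiTwo_sub_le _ _).trans ?_
    have : |x| ≤ |d| + |e| := by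
      rcases Set.mem_uIcc.1 hx with ⟨h1, h2⟩ | ⟨h1, h2⟩ <;>
      · rw [abs_le]
        constructor <;> linarith [neg_abs_le d, neg_abs_le e, le_abs_self d, le_abs_self e,
          abs_nonneg d, abs_nonneg e]
    simpa using this

/-- The Bregman divergence of `psi`. -/
noncomputable def breg (t d : ℝ) : ℝ := psi (t + d) - psi t - Real.sigmoid t * d

lemma breg_pos {d : ℝ} (t : ℝ) (hd : d ≠ 0) : 0 < breg t d := by
  have hc : Continuous psi := contDiff_psi.continuous
  rcases lt_or_gt_of_ne hd with h | h
  · obtain ⟨c, hc1, hc2⟩ := exists_hasDerivAt_eq_slope psi Real.sigmoid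
      (show t + d < t by linarith) hc.continuousOn fun x _ => hasDerivAt_psi x
    rw [eq_div_iff (by linarith)] at hc2
    have := Real.sigmoid_strictMono hc1.2
    simp only [breg]
    nlinarith
  · obtain ⟨c, hc1, hc2⟩ := exists_hasDerivAt_eq_slope psi Real.sigmoid
      (show t < t + d by linarith) hc.continuousOn fun x _ => hasDerivAt_psi x
    rw [eq_div_iff (by linarith)] at hc2
    have := Real.sigmoid_strictMono hc1.1
    simp only [breg]
    nlinarith

lemma breg_nonneg (t d : ℝ) : 0 ≤ breg t d := by
  rcases eq_or_ne d 0 with rfl | h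
  · simp [breg]
  · exact (breg_pos t h).le

/-- Convexity: the tangent at `t + θ * d` lies below `psi` at both ends `t + d` and `t`; the two
inequalities are averaged with weights `θ` and `1 - θ`. -/
lemma breg_mul_le {θ : ℝ} (t d : ℝ) (h0 : 0 ≤ θ) (h1 : θ ≤ 1) :
    breg t (θ * d) ≤ θ * breg t d := by
  have k1 := breg_nonneg (t + θ * d) ((1 - θ) * d)
  have k2 := breg_nonneg (t + θ * d) (-(θ * d))
  simp only [breg] at *
  rw [show t + θ * d + (1 - θ) * d = t + d by ring] at k1
  rw [show t + θ * d + -(θ * d) = t by ring] at k2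
  nlinarith [mul_nonneg h0 k1, mul_nonneg (sub_nonneg.2 h1) k2]

/-- In `1 / (exp t + 2 + exp (-t))`, a shift by `u` multiplies each term of the denominator by at
most `exp |u|`. -/
lemma psiTwo_add_ge (t u : ℝ) : psiTwo t * (1 - |u|) ≤ psiTwo (t + u) := by
  have h0 : Real.exp (-|u|) * psiTwo t ≤ psiTwo (t + u) := by
    rw [psiTwo_eq, psiTwo_eq, Real.exp_neg, ← mul_inv]
    apply inv_anti₀ (by positivity)
    rw [neg_add, Real.exp_add, Real.exp_add]
    have h1 : Real.exp u ≤ Real.exp |u| := Real.exp_le_exp.2 (le_abs_self u)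
    have h2 : Real.exp (-u) ≤ Real.exp |u| := Real.exp_le_exp.2 (neg_le_abs u)
    have h3 : 1 ≤ Real.exp |u| := Real.one_le_exp (abs_nonneg u)
    nlinarith [mul_le_mul_of_nonneg_left h1 (Real.exp_pos t).le,
      mul_le_mul_of_nonneg_left h2 (Real.exp_pos (-t)).le]
  have h1 : 1 - |u| ≤ Real.exp (-|u|) := by linarith [Real.add_one_le_exp (-|u|)]
  nlinarith [psiTwo_pos t]

/-- The bound `psiTwo (t + u * d) ≥ psiTwo t * (1 - u)` is integrated twice over `u ∈ [0, 1]`; the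
constant is `1/2 - 1/6 = 1/3`. Each integration is the monotonicity of a difference. -/
lemma breg_ge (t : ℝ) {d : ℝ} (hd : |d| ≤ 1) : psiTwo t * d ^ 2 / 3 ≤ breg t d := by
  have hline : ∀ u : ℝ, HasDerivAt (fun u : ℝ => t + u * d) d u := fun u => by
    simpa using ((hasDerivAt_id u).mul_const d).const_add t
  have hmono1 : MonotoneOn (fun u : ℝ => Real.sigmoid (t + u * d) * d - Real.sigmoid t * d
      - psiTwo t * d ^ 2 * (u - u ^ 2 / 2)) (Set.Icc 0 1) := by
    have hD : ∀ u : ℝ, HasDerivAt (fun u : ℝ => Real.sigmoid (t + u * d) * d - Real.sigmoid t * d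
      - psiTwo t * d ^ 2 * (u - u ^ 2 / 2))
        (psiTwo (t + u * d) * d * d - psiTwo t * d ^ 2 * (1 - u)) u := fun u => by
      have h1 := ((hasDerivAt_sigmoid_psiTwo (t + u * d)).comp u (hline u)).mul_const d
      have h2 : HasDerivAt (fun u : ℝ => u - u ^ 2 / 2) (1 - u) u := by
        have := (hasDerivAt_id u).sub ((hasDerivAt_pow 2 u).div_const 2)
        convert! this using 1
        simp
      exact (h1.sub_const _).sub (h2.const_mul _)
    refine monotoneOn_of_deriv_nonneg (convex_Icc 0 1)
      (fun u _ => (hD u).continuousAt.continuousWithinAt)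
      (fun u _ => (hD u).differentiableAt.differentiableWithinAt) fun u hu => ?_
    rw [interior_Icc] at hu
    rw [(hD u).deriv]
    have h1 := psiTwo_add_ge t (u * d)
    have h2 : |u * d| ≤ u := by
      rw [abs_mul, abs_of_pos hu.1]
      exact mul_le_of_le_one_right hu.1.le hd
    have h3 : psiTwo t * (1 - u) ≤ psiTwo (t + u * d) := by nlinarith [psiTwo_pos t]
    nlinarith [mul_le_mul_of_nonneg_right h3 (sq_nonneg d)]
  have hmono2 : MonotoneOn (fun u : ℝ => psi (t + u * d) - Real.sigmoid t * d * u
      - psiTwo t * d ^ 2 * (u ^ 2 / 2 - u ^ 3 / 6)) (Set.Icc 0 1) := by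
    have hD : ∀ u : ℝ, HasDerivAt (fun u : ℝ => psi (t + u * d) - Real.sigmoid t * d * u
      - psiTwo t * d ^ 2 * (u ^ 2 / 2 - u ^ 3 / 6))
        (Real.sigmoid (t + u * d) * d - Real.sigmoid t * d
      - psiTwo t * d ^ 2 * (u - u ^ 2 / 2)) u := fun u => by
      have h1 := (hasDerivAt_psi (t + u * d)).comp u (hline u)
      have h2 : HasDerivAt (fun u : ℝ => u ^ 2 / 2 - u ^ 3 / 6) (u - u ^ 2 / 2) u := by
        have := ((hasDerivAt_pow 2 u).div_const 2).sub ((hasDerivAt_pow 3 u).div_const 6)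
        convert! this using 1
        norm_num
        ring
      have h3 : HasDerivAt (fun u : ℝ => Real.sigmoid t * d * u) (Real.sigmoid t * d) u := by
        simpa using (hasDerivAt_id u).const_mul (Real.sigmoid t * d)
      exact (h1.sub h3).sub (h2.const_mul _)
    refine monotoneOn_of_deriv_nonneg (convex_Icc 0 1)
      (fun u _ => (hD u).continuousAt.continuousWithinAt)
      (fun u _ => (hD u).differentiableAt.differentiableWithinAt) fun u hu => ?_
    rw [interior_Icc] at hu
    rw [(hD u).deriv]
    have := hmono1 (Set.left_mem_Icc.2 zero_le_one) (Set.Ioo_subset_Icc_self hu) hu.1.le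
    simpa using this
  have h := hmono2 (Set.left_mem_Icc.2 zero_le_one) (Set.right_mem_Icc.2 zero_le_one) zero_le_one
  simp only [breg] at h ⊢
  norm_num at h
  linarith

/-- The expression is affine in `y`, so the cases `y = 0` and `y = 1` suffice. This bounds the loss
below, which makes the lasso objective coercive. -/
lemma psi_sub_mul_nonneg {y : ℝ} (t : ℝ) (h0 : 0 ≤ y) (h1 : y ≤ 1) : 0 ≤ -(y * t) + psi t := by
  have k0 : 0 ≤ psi t := Real.log_nonneg (by linarith [Real.exp_pos t])
  have k1 : t ≤ psi t := by
    rw [psi, Real.le_log_iff_exp_le (by positivity)]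
    linarith
  nlinarith

/-! ### Expansion of the loss and the restricted eigenvalue. -/

variable {n p : ℕ}

/-- The gradient of the loss. -/
noncomputable def grad (X : Matrix (Fin n) (Fin p) ℝ) (y : Fin n → ℝ) (b : Fin p → ℝ) (j : Fin p) :
    ℝ :=
  (1 / (n : ℝ)) * ∑ i, X i j * (Real.sigmoid ((X *ᵥ b) i) - y i)

/-- The Bregman divergence of the loss. -/
noncomputable def bregLoss (X : Matrix (Fin n) (Fin p) ℝ) (b d : Fin p → ℝ) : ℝ :=
  (1 / (n : ℝ)) * ∑ i, breg ((X *ᵥ b) i) ((X *ᵥ d) i)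

lemma loss_add (X : Matrix (Fin n) (Fin p) ℝ) (y : Fin n → ℝ) (b d : Fin p → ℝ) :
    loss X y (b + d) = loss X y b + ∑ j, grad X y b j * d j + bregLoss X b d := by
  have e : ∑ j, grad X y b j * d j
      = (1 / (n : ℝ)) * ∑ i, (Real.sigmoid ((X *ᵥ b) i) - y i) * (X *ᵥ d) i := by
    simp only [grad, Matrix.mulVec, dotProduct, Finset.mul_sum, Finset.sum_mul]
    rw [Finset.sum_comm]
    refine Finset.sum_congr rfl fun i _ => Finset.sum_congr rfl fun j _ => ?_
    ring
  rw [e, loss, loss, bregLoss, ← mul_add, ← mul_add, ← Finset.sum_add_distrib,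
    ← Finset.sum_add_distrib]
  congr 1
  refine Finset.sum_congr rfl fun i _ => ?_
  simp only [Matrix.mulVec_add, Pi.add_apply, breg]
  ring

lemma bregLoss_nonneg (X : Matrix (Fin n) (Fin p) ℝ) (b d : Fin p → ℝ) : 0 ≤ bregLoss X b d :=
  mul_nonneg (by positivity) (Finset.sum_nonneg fun _ _ => breg_nonneg _ _)

lemma bregLoss_pos (X : Matrix (Fin n) (Fin p) ℝ) (b : Fin p → ℝ) {d : Fin p → ℝ}
    (hd : X *ᵥ d ≠ 0) : 0 < bregLoss X b d := by
  obtain ⟨i, hi⟩ : ∃ i, (X *ᵥ d) i ≠ 0 := Function.ne_iff.1 hd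
  have hn : (0 : ℝ) < n := by
    exact_mod_cast i.pos
  have hs : 0 < ∑ i, breg ((X *ᵥ b) i) ((X *ᵥ d) i) :=
    Finset.sum_pos' (fun _ _ => breg_nonneg _ _) ⟨i, Finset.mem_univ _, breg_pos _ hi⟩
  rw [bregLoss]
  positivity

lemma bregLoss_smul_le (X : Matrix (Fin n) (Fin p) ℝ) (b d : Fin p → ℝ) {θ : ℝ} (h0 : 0 ≤ θ)
    (h1 : θ ≤ 1) : bregLoss X b (θ • d) ≤ θ * bregLoss X b d := by
  rw [bregLoss, bregLoss, mul_left_comm, Finset.mul_sum _ _ θ]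
  refine mul_le_mul_of_nonneg_left (Finset.sum_le_sum fun i _ => ?_) (by positivity)
  rw [Matrix.mulVec_smul]
  exact breg_mul_le _ _ h0 h1

lemma hess_quadForm (X : Matrix (Fin n) (Fin p) ℝ) (b u : Fin p → ℝ) :
    u ⬝ᵥ (hess X b *ᵥ u) = (1 / (n : ℝ)) * ∑ i, psiTwo ((X *ᵥ b) i) * (X *ᵥ u) i ^ 2 := by
  rw [hess, Matrix.smul_mulVec, dotProduct_smul, smul_eq_mul, Matrix.mul_assoc,
    ← Matrix.mulVec_mulVec, Matrix.dotProduct_mulVec, Matrix.vecMul_transpose,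
    ← Matrix.mulVec_mulVec]
  congr 1
  simp only [dotProduct, Sig, Matrix.mulVec_diagonal, deriv_deriv_psi]
  refine Finset.sum_congr rfl fun i _ => ?_
  ring

lemma bregLoss_ge (X : Matrix (Fin n) (Fin p) ℝ) (b d : Fin p → ℝ)
    (hd : ∀ i, |(X *ᵥ d) i| ≤ 1) : d ⬝ᵥ (hess X b *ᵥ d) / 3 ≤ bregLoss X b d := by
  rw [hess_quadForm, mul_div_assoc, Finset.sum_div]
  exact mul_le_mul_of_nonneg_left (Finset.sum_le_sum fun i _ => breg_ge _ (hd i)) (by positivity)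

lemma kappaLogit_mul_le (X : Matrix (Fin n) (Fin p) ℝ) (βs u : Fin p → ℝ)
    (hu : ∑ j ∈ (supp βs)ᶜ, |u j| ≤ 3 * ∑ j ∈ supp βs, |u j|) :
    kappaLogit X βs * (u ⬝ᵥ u) ≤ u ⬝ᵥ (hess X βs *ᵥ u) := by
  by_cases h0 : u = 0
  · simp [h0]
  have hpos : 0 < u ⬝ᵥ u := by
    refine lt_of_le_of_ne (Finset.sum_nonneg fun j _ => mul_self_nonneg (u j)) fun h => h0 ?_
    exact dotProduct_self_eq_zero.1 h.symm
  rw [← le_div_iff₀ hpos]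
  refine csInf_le ⟨0, ?_⟩ ⟨u, h0, hu, rfl⟩
  rintro r ⟨v, -, -, rfl⟩
  refine div_nonneg ?_ (Finset.sum_nonneg fun j _ => mul_self_nonneg (v j))
  rw [hess_quadForm]
  exact mul_nonneg (by positivity)
    (Finset.sum_nonneg fun i _ => mul_nonneg (psiTwo_pos _).le (sq_nonneg _))

/-- Vectors supported on the true support lie trivially in the cone. The resulting injectivity gives
both the uniqueness of minimizers and the invertibility of the Gram matrix. -/
lemma mulVec_ne_zero_of_kappaLogit_pos {X : Matrix (Fin n) (Fin p) ℝ} {βs : Fin p → ℝ}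
    (hκ : 0 < kappaLogit X βs) {d : Fin p → ℝ} (hd : ∀ j ∉ supp βs, d j = 0) (h0 : d ≠ 0) :
    X *ᵥ d ≠ 0 := by
  intro h
  have h1 := kappaLogit_mul_le X βs d (by
    rw [Finset.sum_eq_zero fun j hj => by rw [hd j (Finset.mem_compl.1 hj), abs_zero]]
    positivity)
  rw [hess_quadForm, h] at h1
  have hpos : 0 < d ⬝ᵥ d := by
    refine lt_of_le_of_ne (Finset.sum_nonneg fun j _ => mul_self_nonneg (d j)) fun h => h0 ?_
    exact dotProduct_self_eq_zero.1 h.symm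
  simp only [Pi.zero_apply] at h1
  norm_num at h1
  nlinarith [mul_pos hκ hpos]

/-- With empty support the cone contains only `0`, and `sInf ∅ = 0`. -/
lemma supp_nonempty {X : Matrix (Fin n) (Fin p) ℝ} {βs : Fin p → ℝ}
    (hκ : 0 < kappaLogit X βs) : (supp βs).Nonempty := by
  by_contra h
  rw [Finset.not_nonempty_iff_eq_empty] at h
  have : {r : ℝ | ∃ u : Fin p → ℝ, u ≠ 0 ∧
      ∑ j ∈ (supp βs)ᶜ, |u j| ≤ 3 * ∑ j ∈ supp βs, |u j| ∧
      r = (u ⬝ᵥ (hess X βs *ᵥ u)) / (u ⬝ᵥ u)} = ∅ := by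
    refine Set.eq_empty_of_forall_notMem ?_
    rintro r ⟨u, hu, hle, -⟩
    rw [h] at hle
    simp only [Finset.compl_empty, Finset.sum_empty, mul_zero] at hle
    refine hu (funext fun j => ?_)
    have := (Finset.sum_eq_zero_iff_of_nonneg fun j _ => abs_nonneg (u j)).1
      (le_antisymm hle (Finset.sum_nonneg fun j _ => abs_nonneg (u j))) j (Finset.mem_univ j)
    simpa using this
  rw [kappaLogit, this, Real.sInf_empty] at hκ
  exact lt_irrefl _ hκ

/-! ### Optimality conditions and the deterministic behaviour of LLA. -/

lemma isWeightedLasso_iff {X : Matrix (Fin n) (Fin p) ℝ} {y : Fin n → ℝ} {βs bo : Fin p → ℝ}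
    {w : Fin p → ℝ} (hκ : 0 < kappaLogit X βs) (hbo : ∀ j ∉ supp βs, bo j = 0)
    (hgA : ∀ j ∈ supp βs, grad X y bo j = 0) (hwA : ∀ j ∈ supp βs, w j = 0)
    (hw : ∀ j ∉ supp βs, |grad X y bo j| < w j) (b : Fin p → ℝ) :
    IsWeightedLasso X y w b ↔ b = bo := by
  have key : ∀ c : Fin p → ℝ, c ≠ bo →
      loss X y bo + ∑ j, w j * |bo j| < loss X y c + ∑ j, w j * |c j| := by
    intro c hc
    have hterm : ∀ j, w j * |bo j| ≤ grad X y bo j * (c - bo) j + w j * |c j| := by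
      intro j
      by_cases hj : j ∈ supp βs
      · simp [hgA j hj, hwA j hj]
      · have h1 := neg_abs_le (grad X y bo j * c j)
        rw [abs_mul] at h1
        simp only [Pi.sub_apply, hbo j hj, abs_zero, mul_zero, sub_zero]
        nlinarith [mul_nonneg (sub_nonneg.2 (hw j hj).le) (abs_nonneg (c j))]
    have hsum : ∑ j, w j * |bo j| ≤ ∑ j, grad X y bo j * (c - bo) j + ∑ j, w j * |c j| := by
      rw [← Finset.sum_add_distrib]
      exact Finset.sum_le_sum fun j _ => hterm j
    have hl := loss_add X y bo (c - bo)
    rw [add_sub_cancel] at hl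
    -- Strictness has two sources: strict convexity along the support if `c` vanishes off it, and
    -- otherwise the strict gap between weight and gradient at a nonzero off-support entry.
    by_cases hoff : ∀ j ∉ supp βs, c j = 0
    · have := bregLoss_pos X bo (mulVec_ne_zero_of_kappaLogit_pos hκ (d := c - bo)
        (fun j hj => by simp [hoff j hj, hbo j hj]) (sub_ne_zero.2 hc))
      linarith
    · push Not at hoff
      obtain ⟨k, hk, hck⟩ := hoff
      have hlt : w k * |bo k| < grad X y bo k * (c - bo) k + w k * |c k| := by
        have h1 := neg_abs_le (grad X y bo k * c k)
        rw [abs_mul] at h1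
        simp only [Pi.sub_apply, hbo k hk, abs_zero, mul_zero, sub_zero]
        nlinarith [mul_pos (sub_pos.2 (hw k hk)) (abs_pos.2 hck)]
      have hsum : ∑ j, w j * |bo j| < ∑ j, grad X y bo j * (c - bo) j + ∑ j, w j * |c j| := by
        rw [← Finset.sum_add_distrib]
        exact Finset.sum_lt_sum (fun j _ => hterm j) ⟨k, Finset.mem_univ _, hlt⟩
      linarith [bregLoss_nonneg X bo (c - bo)]
  constructor
  · intro h
    by_contra hne
    exact absurd (h (Set.mem_univ bo)) (not_le.2 (key b hne))
  · rintro rfl c -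
    by_cases hc : c = b
    · exact hc ▸ le_refl (loss X y b + ∑ j, w j * |b j|)
    · exact (key c hc).le

lemma isOracle_iff {X : Matrix (Fin n) (Fin p) ℝ} {y : Fin n → ℝ} {βs bo : Fin p → ℝ}
    (hκ : 0 < kappaLogit X βs) (hbo : ∀ j ∉ supp βs, bo j = 0)
    (hgA : ∀ j ∈ supp βs, grad X y bo j = 0) (b : Fin p → ℝ) :
    IsOracle X y βs b ↔ b = bo := by
  have key : ∀ c : Fin p → ℝ, (∀ j ∉ supp βs, c j = 0) → c ≠ bo →
      loss X y bo < loss X y c := by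
    intro c hc hne
    have hl := loss_add X y bo (c - bo)
    rw [add_sub_cancel] at hl
    have h0 : ∑ j, grad X y bo j * (c - bo) j = 0 := by
      refine Finset.sum_eq_zero fun j _ => ?_
      by_cases hj : j ∈ supp βs
      · simp [hgA j hj]
      · simp [hc j hj, hbo j hj]
    have := bregLoss_pos X bo (mulVec_ne_zero_of_kappaLogit_pos hκ (d := c - bo)
        (fun j hj => by simp [hc j hj, hbo j hj]) (sub_ne_zero.2 hne))
    linarith
  constructor
  · rintro ⟨h1, h2⟩
    by_contra hne
    exact absurd (h2 hbo) (not_le.2 (key b h1 hne))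
  · rintro rfl
    refine ⟨hbo, fun c hc => ?_⟩
    by_cases h : c = b
    · exact h ▸ le_refl (loss X y b)
    · exact (key c hc h).le

lemma le_penaltyDeriv {P : ℝ → ℝ} {lam a₁ a₂ a : ℝ} (hP : IsFoldedConcave P lam a₁ a₂ a) {t : ℝ}
    (h0 : 0 ≤ t) (ht : t ≤ a₂ * lam) : a₁ * lam ≤ penaltyDeriv P t := by
  unfold penaltyDeriv
  split_ifs with h
  · obtain ⟨d, hd, hle⟩ := hP.deriv_zero
    rwa [hd.limUnder_eq]
  · exact hP.deriv_small t (lt_of_le_of_ne h0 (Ne.symm h)) ht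

lemma penaltyDeriv_eq_zero {P : ℝ → ℝ} {lam a₁ a₂ a : ℝ} (hP : IsFoldedConcave P lam a₁ a₂ a)
    {t : ℝ} (h0 : 0 < t) (ht : a * lam ≤ t) : penaltyDeriv P t = 0 := by
  rw [penaltyDeriv, if_neg h0.ne', hP.deriv_large t ht]

lemma minSignal_le {βs : Fin p → ℝ} {j : Fin p} (hj : j ∈ supp βs) : minSignal βs ≤ |βs j| :=
  ciInf_le (f := fun k : supp βs => |βs k|) (Set.finite_range _).bddBelow ⟨j, hj⟩

/-- The deterministic part of the argument: the algorithm reaches the oracle estimator `bo` as soon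
as `bo` is stationary on the support, has small gradient off it and large entries on it, and every
initial estimator is close to the true coefficients. -/
theorem llaReachesOracle_of_bounds {X : Matrix (Fin n) (Fin p) ℝ} {y : Fin n → ℝ}
    {βs bo : Fin p → ℝ} {P : ℝ → ℝ} {lam lamLasso a₁ a₂ a : ℝ}
    (hP : IsFoldedConcave P lam a₁ a₂ a) (hlam : 0 < lam)
    (hmin : (a + 1) * lam < minSignal βs) (hκ : 0 < kappaLogit X βs)
    (hbo : ∀ j ∉ supp βs, bo j = 0) (hgA : ∀ j ∈ supp βs, grad X y bo j = 0)
    (hg : ∀ j ∉ supp βs, |grad X y bo j| < a₁ * lam)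
    (hbig : ∀ j ∈ supp βs, a * lam < |bo j|)
    (hex : ∃ b, IsLasso X y lamLasso b)
    (hclose : ∀ b, IsLasso X y lamLasso b → ∀ j, |b j - βs j| ≤ min 1 a₂ * lam) :
    LLAReachesOracle X βs P lamLasso y := by
  have ha : 0 < a * lam := mul_pos (hP.a₂_pos.trans hP.a₂_lt) hlam
  have step : ∀ b : Fin p → ℝ, (∀ j ∈ supp βs, a * lam ≤ |b j|) →
      (∀ j ∉ supp βs, |b j| ≤ a₂ * lam) → ∀ c,
      IsWeightedLasso X y (fun j => penaltyDeriv P |b j|) c ↔ c = bo := by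
    intro b h1 h2 c
    refine isWeightedLasso_iff hκ hbo hgA (fun j hj => ?_) (fun j hj => ?_) c
    · exact penaltyDeriv_eq_zero hP (ha.trans_le (h1 j hj)) (h1 j hj)
    · exact (hg j hj).trans_le (le_penaltyDeriv hP (abs_nonneg _) (h2 j hj))
  have stepo := step bo (fun j hj => (hbig j hj).le) fun j hj => by
    rw [hbo j hj, abs_zero]
    exact (mul_pos hP.a₂_pos hlam).le
  refine ⟨bo, isOracle_iff hκ hbo hgA, hex, fun b₀ hb₀ => ?_⟩
  have step0 := step b₀ (fun j hj => ?_) fun j hj => ?_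
  · refine ⟨⟨fun k => if k = 0 then b₀ else bo, fun k => ?_, by simp⟩, fun B hB hB0 k hk => ?_⟩
    · rcases k with _ | k
      · simpa using (step0 bo).2 rfl
      · simpa using (stepo bo).2 rfl
    · induction k, hk using Nat.le_induction with
      | base =>
        have := hB 0
        rw [hB0] at this
        exact (step0 _).1 this
      | succ k _ ih =>
        have := hB k
        rw [ih] at this
        exact (stepo _).1 this
  -- On the support: an error of at most `lam` (as `min 1 a₂ ≤ 1`) leaves more than `(a + 1) * lam -
  -- lam = a * lam`.
  · have h1 := hclose b₀ hb₀ j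
    have h2 := minSignal_le hj
    have h3 := abs_sub_abs_le_abs_sub (βs j) (b₀ j)
    rw [abs_sub_comm] at h3
    nlinarith [mul_le_mul_of_nonneg_right (min_le_left 1 a₂) hlam.le]
  · have h1 := hclose b₀ hb₀ j
    have h2 : βs j = 0 := by simpa [supp] using hj
    rw [h2, sub_zero] at h1
    exact h1.trans (mul_le_mul_of_nonneg_right (min_le_right 1 a₂) hlam.le)

/-! ### Existence and error bound of the lasso. -/

lemma continuous_loss (X : Matrix (Fin n) (Fin p) ℝ) (y : Fin n → ℝ) : Continuous (loss X y) := by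
  have := contDiff_psi.continuous
  unfold loss Matrix.mulVec dotProduct
  fun_prop

lemma exists_isLasso (X : Matrix (Fin n) (Fin p) ℝ) {y : Fin n → ℝ}
    (hy : ∀ i, 0 ≤ y i ∧ y i ≤ 1) {lamLasso : ℝ} (hl : 0 < lamLasso) :
    ∃ b, IsLasso X y lamLasso b := by
  have hcont : Continuous fun c : Fin p → ℝ => loss X y c + lamLasso * ∑ j, |c j| := by
    have := continuous_loss X y
    fun_prop
  have hge : ∀ c : Fin p → ℝ, lamLasso * ‖c‖ ≤ loss X y c + lamLasso * ∑ j, |c j| := by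
    intro c
    have h1 : 0 ≤ loss X y c := mul_nonneg (by positivity)
      (Finset.sum_nonneg fun i _ => psi_sub_mul_nonneg _ (hy i).1 (hy i).2)
    have h2 : ‖c‖ ≤ ∑ j, |c j| := by
      refine (pi_norm_le_iff_of_nonneg (Finset.sum_nonneg fun j _ => abs_nonneg _)).2 fun j => ?_
      exact Finset.single_le_sum (f := fun j => |c j|) (fun j _ => abs_nonneg _) (Finset.mem_univ j)
    nlinarith
  have hlim : Tendsto (fun c : Fin p → ℝ => loss X y c + lamLasso * ∑ j, |c j|)
      (cocompact (Fin p → ℝ)) atTop :=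
    tendsto_atTop_mono hge (Tendsto.const_mul_atTop hl tendsto_norm_cocompact_atTop)
  obtain ⟨b, hb⟩ := hcont.exists_forall_le hlim
  exact ⟨b, fun c _ => hb c⟩

lemma abs_le_maxEntry (X : Matrix (Fin n) (Fin p) ℝ) (i : Fin n) (j : Fin p) :
    |X i j| ≤ maxEntry X :=
  le_ciSup (f := fun ij : Fin n × Fin p => |X ij.1 ij.2|) (Set.finite_range _).bddAbove (i, j)

lemma abs_mulVec_le (X : Matrix (Fin n) (Fin p) ℝ) (d : Fin p → ℝ) (i : Fin n) :
    |(X *ᵥ d) i| ≤ maxEntry X * ∑ j, |d j| := by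
  rw [Matrix.mulVec, dotProduct, Finset.mul_sum]
  refine (Finset.abs_sum_le_sum_abs _ _).trans (Finset.sum_le_sum fun j _ => ?_)
  rw [abs_mul]
  exact mul_le_mul_of_nonneg_right (abs_le_maxEntry X i j) (abs_nonneg _)

lemma abs_sq_le_dotProduct (d : Fin p → ℝ) (j : Fin p) : |d j| ^ 2 ≤ d ⬝ᵥ d := by
  rw [sq_abs, dotProduct, sq]
  exact Finset.single_le_sum (f := fun j => d j * d j) (fun j _ => mul_self_nonneg _)
    (Finset.mem_univ j)

lemma sum_abs_sq_le (S : Finset (Fin p)) (d : Fin p → ℝ) :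
    (∑ j ∈ S, |d j|) ^ 2 ≤ S.card * (d ⬝ᵥ d) := by
  refine sq_sum_le_card_mul_sum_sq.trans (mul_le_mul_of_nonneg_left ?_ (by positivity))
  simp only [sq_abs, dotProduct, ← sq]
  exact Finset.sum_le_sum_of_subset_of_nonneg (Finset.subset_univ _) fun j _ _ => sq_nonneg _

/-- The basic inequality for the lasso. -/
lemma bregLoss_add_le_of_isLasso {X : Matrix (Fin n) (Fin p) ℝ} {y : Fin n → ℝ}
    {βs b : Fin p → ℝ} {lamLasso : ℝ} (hl : 0 < lamLasso)
    (hg : ∀ j, |grad X y βs j| ≤ lamLasso / 2) (hb : IsLasso X y lamLasso b) :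
    bregLoss X βs (b - βs) + lamLasso / 2 * ∑ j ∈ (supp βs)ᶜ, |(b - βs) j| ≤
      3 / 2 * lamLasso * ∑ j ∈ supp βs, |(b - βs) j| := by
  have h0 : loss X y b + lamLasso * ∑ j, |b j| ≤ loss X y βs + lamLasso * ∑ j, |βs j| :=
    hb (Set.mem_univ βs)
  have hl' := loss_add X y βs (b - βs)
  rw [add_sub_cancel] at hl'
  -- On the support the gradient costs `lamLasso / 2` and the penalty `lamLasso` per unit of error;
  -- off it the penalty gains `lamLasso`, of which the gradient takes half.
  have hA : ∀ j ∈ supp βs, - (3 / 2 * lamLasso * |(b - βs) j|) ≤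
      grad X y βs j * (b - βs) j + lamLasso * |b j| - lamLasso * |βs j| := by
    intro j _
    have h1 := neg_abs_le (grad X y βs j * (b - βs) j)
    rw [abs_mul] at h1
    have h2 := mul_le_mul_of_nonneg_right (hg j) (abs_nonneg ((b - βs) j))
    have h3 := abs_sub_abs_le_abs_sub (βs j) (b j)
    rw [abs_sub_comm] at h3
    have h4 := mul_le_mul_of_nonneg_left h3 hl.le
    simp only [Pi.sub_apply] at *
    linarith
  have hAc : ∀ j ∈ (supp βs)ᶜ, lamLasso / 2 * |(b - βs) j| ≤
      grad X y βs j * (b - βs) j + lamLasso * |b j| - lamLasso * |βs j| := by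
    intro j hj
    have hz : βs j = 0 := by simpa [supp] using hj
    have h1 := neg_abs_le (grad X y βs j * (b - βs) j)
    rw [abs_mul] at h1
    have h2 := mul_le_mul_of_nonneg_right (hg j) (abs_nonneg ((b - βs) j))
    simp only [Pi.sub_apply, hz, sub_zero, abs_zero, mul_zero] at *
    linarith
  have sA := Finset.sum_le_sum hA
  have sAc := Finset.sum_le_sum hAc
  have split := Finset.sum_add_sum_compl (supp βs)
    fun j => grad X y βs j * (b - βs) j + lamLasso * |b j| - lamLasso * |βs j|
  rw [Finset.sum_sub_distrib (s := Finset.univ), Finset.sum_add_distrib (s := Finset.univ),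
    ← Finset.mul_sum Finset.univ, ← Finset.mul_sum Finset.univ] at split
  rw [Finset.sum_neg_distrib, ← Finset.mul_sum] at sA
  rw [← Finset.mul_sum] at sAc
  linarith

/-- The `ℓ₂` bound for the lasso under the restricted eigenvalue condition. -/
theorem sq_norm_sub_le_of_isLasso {X : Matrix (Fin n) (Fin p) ℝ} {y : Fin n → ℝ}
    {βs b : Fin p → ℝ} {lamLasso : ℝ} (hl : 0 < lamLasso) (hκ : 0 < kappaLogit X βs)
    (hlasso : lamLasso ≤ kappaLogit X βs / (20 * maxEntry X * ((supp βs).card : ℝ)))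
    (hg : ∀ j, |grad X y βs j| ≤ lamLasso / 2) (hb : IsLasso X y lamLasso b) :
    (b - βs) ⬝ᵥ (b - βs) ≤
      (5 * Real.sqrt ((supp βs).card : ℝ) * lamLasso / kappaLogit X βs) ^ 2 := by
  set κ := kappaLogit X βs
  set s : ℝ := ((supp βs).card : ℝ)
  set d := b - βs
  set r := 5 * Real.sqrt s * lamLasso / κ with hr
  have hs : 0 < s := Nat.cast_pos.2 (supp_nonempty hκ).card_pos
  have hrpos : 0 < r := by positivity
  have hbasic := bregLoss_add_le_of_isLasso hl hg hb
  have hcone : ∑ j ∈ (supp βs)ᶜ, |d j| ≤ 3 * ∑ j ∈ supp βs, |d j| := by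
    have := bregLoss_nonneg X βs d
    nlinarith
  by_contra hlt
  push Not at hlt
  set h := Real.sqrt (d ⬝ᵥ d) with hh
  have hd0 : 0 ≤ d ⬝ᵥ d := (sq_nonneg r).trans hlt.le
  have hhsq : h ^ 2 = d ⬝ᵥ d := Real.sq_sqrt hd0
  have hrh : r < h := Real.lt_sqrt_of_sq_lt hlt
  have hhpos : 0 < h := hrpos.trans hrh
  have hl1 : ∑ j ∈ supp βs, |d j| ≤ Real.sqrt s * h := by
    refine le_of_sq_le_sq ?_ (by positivity)
    rw [mul_pow, Real.sq_sqrt hs.le, hhsq]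
    exact sum_abs_sq_le _ _
  have hall : ∑ j, |d j| ≤ 4 * (Real.sqrt s * h) := by
    rw [← Finset.sum_add_sum_compl (supp βs)]
    linarith
  -- Otherwise the upper bound for `lamLasso` would be nonpositive, also under `x / 0 = 0`.
  have hm : 0 < maxEntry X := by
    by_contra hm
    have : kappaLogit X βs / (20 * maxEntry X * s) ≤ 0 :=
      div_nonpos_of_nonneg_of_nonpos hκ.le (by nlinarith)
    linarith
  have hlm : lamLasso * (20 * maxEntry X * s) ≤ κ := (le_div_iff₀ (by positivity)).1 hlasso
  -- An error longer than `r` is shrunk to length exactly `r`, where the quadratic lower bound is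
  -- available.
  set θ := r / h with hθ
  have hθ0 : 0 < θ := by positivity
  have hθ1 : θ ≤ 1 := (div_le_one hhpos).2 hrh.le
  have hθh : θ * h = r := div_mul_cancel₀ _ hhpos.ne'
  have hκr : κ * r = 5 * Real.sqrt s * lamLasso := by
    rw [hr]; field_simp
  -- The shrunken error has `ℓ₁` norm at most `4 √s r`, so the predictors move by at most `4 m √s r
  -- = 20 m s lamLasso / κ`; hence the 20 in the hypothesis.
  have hsmall : ∀ i, |(X *ᵥ (θ • d)) i| ≤ 1 := by
    intro i
    rw [Matrix.mulVec_smul, Pi.smul_apply, smul_eq_mul, abs_mul, abs_of_pos hθ0]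
    have h1 := (abs_mulVec_le X d i).trans (mul_le_mul_of_nonneg_left hall hm.le)
    have h2 : θ * |(X *ᵥ d) i| ≤ 4 * maxEntry X * Real.sqrt s * r := by
      calc θ * |(X *ᵥ d) i| ≤ θ * (maxEntry X * (4 * (Real.sqrt s * h))) :=
            mul_le_mul_of_nonneg_left h1 hθ0.le
        _ = 4 * maxEntry X * Real.sqrt s * (θ * h) := by ring
        _ = _ := by rw [hθh]
    refine h2.trans (le_of_mul_le_mul_left ?_ hκ)
    calc κ * (4 * maxEntry X * Real.sqrt s * r) = 4 * maxEntry X * Real.sqrt s * (κ * r) := by ring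
      _ = 20 * maxEntry X * (Real.sqrt s * Real.sqrt s) * lamLasso := by rw [hκr]; ring
      _ = lamLasso * (20 * maxEntry X * s) := by rw [Real.mul_self_sqrt hs.le]; ring
      _ ≤ κ * 1 := by linarith
  have hB1 := bregLoss_ge X βs (θ • d) hsmall
  have hB2 := bregLoss_smul_le X βs d hθ0.le hθ1
  have hB3 := kappaLogit_mul_le X βs d hcone
  have hquad : (θ • d) ⬝ᵥ (hess X βs *ᵥ (θ • d)) = θ ^ 2 * (d ⬝ᵥ (hess X βs *ᵥ d)) := by
    rw [Matrix.mulVec_smul, smul_dotProduct, dotProduct_smul, smul_eq_mul, smul_eq_mul]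
    ring
  rw [hquad] at hB1
  have hAc : 0 ≤ ∑ j ∈ (supp βs)ᶜ, |d j| := Finset.sum_nonneg fun j _ => abs_nonneg _
  have hB4 : bregLoss X βs d ≤ 3 / 2 * lamLasso * (Real.sqrt s * h) := by
    have := mul_le_mul_of_nonneg_left hl1 (show 0 ≤ 3 / 2 * lamLasso by positivity)
    nlinarith
  have hB5 : θ ^ 2 * (κ * h ^ 2) / 3 ≤ θ * (3 / 2 * lamLasso * (Real.sqrt s * h)) := by
    rw [← hhsq] at hB3
    have e1 := mul_le_mul_of_nonneg_left hB3 (sq_nonneg θ)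
    have e2 := mul_le_mul_of_nonneg_left hB4 hθ0.le
    linarith
  -- The contradiction is `5/3 > 3/2`; any constant above `9/2` in place of 5 in `r` would serve
  -- here.
  have e3 : θ ^ 2 * (κ * h ^ 2) / 3 = θ * h * (5 / 3 * (Real.sqrt s * lamLasso)) := by
    calc θ ^ 2 * (κ * h ^ 2) / 3 = θ * h * (κ * (θ * h)) / 3 := by ring
      _ = _ := by rw [hθh, hκr]; ring
  have e4 : 0 < θ * h * (Real.sqrt s * lamLasso) := by positivity
  nlinarith

theorem abs_sub_le_of_isLasso {X : Matrix (Fin n) (Fin p) ℝ} {y : Fin n → ℝ}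
    {βs b : Fin p → ℝ} {lam lamLasso a₂ : ℝ} (hl : 0 < lamLasso) (hκ : 0 < kappaLogit X βs)
    (ha₂ : 0 < a₂)
    (hlasso : lamLasso ≤ kappaLogit X βs / (20 * maxEntry X * ((supp βs).card : ℝ)))
    (hlam : 5 * Real.sqrt ((supp βs).card : ℝ) * lamLasso / (min 1 a₂ * kappaLogit X βs) ≤ lam)
    (hg : ∀ j, |grad X y βs j| ≤ lamLasso / 2) (hb : IsLasso X y lamLasso b) (j : Fin p) :
    |b j - βs j| ≤ min 1 a₂ * lam := by
  have h1 := (abs_sq_le_dotProduct (b - βs) j).trans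
    (sq_norm_sub_le_of_isLasso hl hκ hlasso hg hb)
  have h2 : |(b - βs) j| ≤ _ := le_of_sq_le_sq h1 (by positivity)
  have ha₀ : 0 < min 1 a₂ := lt_min one_pos ha₂
  refine h2.trans ?_
  rw [div_le_iff₀ (by positivity)] at hlam
  rw [div_le_iff₀ hκ]
  linarith

/-! ### Bounds through `Q1` and the gradient remainder. -/

lemma quadForm_le_lambdaMax {ι : Type*} [Fintype ι] [DecidableEq ι] {B : Matrix ι ι ℝ}
    (hB : B.IsHermitian) (v : ι → ℝ) : v ⬝ᵥ (B *ᵥ v) ≤ lambdaMax B * (v ⬝ᵥ v) := by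
  have hbdd : BddAbove (spectrum ℝ B) := by
    rw [hB.spectrum_real_eq_range_eigenvalues]
    exact (Set.finite_range _).bddAbove
  have hpsd : (algebraMap ℝ (Matrix ι ι ℝ) (lambdaMax B) - B).PosSemidef := by
    rw [Matrix.posSemidef_iff_isHermitian_and_spectrum_nonneg]
    refine ⟨?_, ?_⟩
    · refine Matrix.IsHermitian.sub ?_ hB
      rw [Matrix.algebraMap_eq_diagonal]
      exact Matrix.isHermitian_diagonal _
    · rw [← spectrum.singleton_sub_eq]
      rintro x ⟨c, rfl, d, hd, rfl⟩
      exact sub_nonneg.2 (le_csSup hbdd hd)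
  have h := hpsd.dotProduct_mulVec_nonneg v
  rw [Matrix.sub_mulVec, dotProduct_sub, Matrix.algebraMap_eq_diagonal] at h
  have e : Matrix.diagonal (algebraMap ℝ (ι → ℝ) (lambdaMax B)) *ᵥ v = lambdaMax B • v := by
    ext i
    simp [Matrix.mulVec_diagonal]
  rw [e, dotProduct_smul, smul_eq_mul, star_trivial] at h
  linarith

lemma linftyNorm_nonneg {ι κ : Type*} [Fintype κ] (B : Matrix ι κ ℝ) : 0 ≤ linftyNorm B :=
  Real.iSup_nonneg fun _ => Finset.sum_nonneg fun _ _ => abs_nonneg _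

lemma abs_mulVec_le_linftyNorm {ι κ : Type*} [Finite ι] [Fintype κ] (B : Matrix ι κ ℝ) (v : κ → ℝ)
    (i : ι) : |(B *ᵥ v) i| ≤ linftyNorm B * ‖v‖ := by
  have h1 : ∑ k, |B i k| ≤ linftyNorm B :=
    le_ciSup (f := fun i => ∑ k, |B i k|) (Set.finite_range _).bddAbove i
  refine le_trans ?_ (mul_le_mul_of_nonneg_right h1 (norm_nonneg v))
  rw [Matrix.mulVec, dotProduct, Finset.sum_mul]
  refine (Finset.abs_sum_le_sum_abs _ _).trans (Finset.sum_le_sum fun k _ => ?_)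
  rw [abs_mul]
  exact mul_le_mul_of_nonneg_left (norm_le_pi_norm v k) (abs_nonneg _)

/-- Extension by zero of a vector indexed by `S`. -/
def extendZero (S : Finset (Fin p)) (v : S → ℝ) (j : Fin p) : ℝ :=
  if h : j ∈ S then v ⟨j, h⟩ else 0

lemma extendZero_of_mem {S : Finset (Fin p)} (v : S → ℝ) {j : Fin p} (h : j ∈ S) :
    extendZero S v j = v ⟨j, h⟩ := dif_pos h

lemma extendZero_of_notMem {S : Finset (Fin p)} (v : S → ℝ) {j : Fin p} (h : j ∉ S) :
    extendZero S v j = 0 := dif_neg h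

lemma mulVec_extendZero (X : Matrix (Fin n) (Fin p) ℝ) (S : Finset (Fin p)) (v : S → ℝ) :
    X *ᵥ extendZero S v = cols X S *ᵥ v := by
  ext i
  simp only [Matrix.mulVec, dotProduct, cols, Matrix.submatrix_apply, id]
  rw [← Finset.sum_subset (Finset.subset_univ S) fun j _ hj => by
    rw [extendZero_of_notMem v hj, mul_zero], ← Finset.sum_coe_sort S]
  exact Finset.sum_congr rfl fun j _ => by rw [extendZero_of_mem v j.2]

lemma quadForm_le_Q1 (X : Matrix (Fin n) (Fin p) ℝ) (βs : Fin p → ℝ) (j : Fin p)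
    (v : supp βs → ℝ) :
    (1 / (n : ℝ)) * ∑ i, |X i j| * (cols X (supp βs) *ᵥ v) i ^ 2 ≤ Q1 X βs * (v ⬝ᵥ v) := by
  set Z := cols X (supp βs)
  set B := (1 / (n : ℝ)) • (Zᵀ * Matrix.diagonal (fun i => |X i j|) * Z) with hBdef
  have hB : B.IsHermitian := by
    rw [Matrix.IsHermitian, Matrix.conjTranspose_eq_transpose_of_trivial, hBdef,
      Matrix.transpose_smul, Matrix.transpose_mul, Matrix.transpose_mul,
      Matrix.transpose_transpose, Matrix.diagonal_transpose, Matrix.mul_assoc]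
  have h1 : lambdaMax B ≤ Q1 X βs :=
    le_ciSup (f := fun j : Fin p => lambdaMax ((1 / (n : ℝ)) •
      (Zᵀ * Matrix.diagonal (fun i => |X i j|) * Z))) (Set.finite_range _).bddAbove j
  have h2 := quadForm_le_lambdaMax hB v
  have h3 : 0 ≤ v ⬝ᵥ v := Finset.sum_nonneg fun _ _ => mul_self_nonneg _
  refine le_trans (le_of_eq ?_) (h2.trans (mul_le_mul_of_nonneg_right h1 h3))
  rw [hBdef, Matrix.smul_mulVec, dotProduct_smul, smul_eq_mul, Matrix.mul_assoc,
    ← Matrix.mulVec_mulVec, Matrix.dotProduct_mulVec, Matrix.vecMul_transpose,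
    ← Matrix.mulVec_mulVec]
  congr 1
  simp only [dotProduct, Matrix.mulVec_diagonal]
  refine Finset.sum_congr rfl fun i _ => ?_
  ring

lemma Q1_nonneg (X : Matrix (Fin n) (Fin p) ℝ) {βs : Fin p → ℝ} (hs : (supp βs).Nonempty) :
    0 ≤ Q1 X βs := by
  obtain ⟨j, hj⟩ := hs
  have h1 := quadForm_le_Q1 X βs j (Pi.single ⟨j, hj⟩ 1)
  rw [single_dotProduct, Pi.single_eq_same, one_mul, mul_one] at h1
  exact le_trans (by positivity) h1

lemma dotProduct_self_le_card_mul {ι : Type*} [Fintype ι] (v : ι → ℝ) :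
    v ⬝ᵥ v ≤ Fintype.card ι * ‖v‖ ^ 2 := by
  rw [dotProduct, ← nsmul_eq_mul]
  refine Finset.sum_le_card_nsmul _ _ _ fun k _ => ?_
  rw [← sq, ← sq_abs]
  exact pow_le_pow_left₀ (abs_nonneg _) (norm_le_pi_norm v k) 2

/-- Cauchy–Schwarz with weights `|X i j|` reduces to the quadratic form; passing from the Euclidean
to the sup norm costs the factor `s`. -/
lemma bilinForm_le_Q1 (X : Matrix (Fin n) (Fin p) ℝ) {βs : Fin p → ℝ} (hs : (supp βs).Nonempty)
    (j : Fin p) (u v : supp βs → ℝ) :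
    (1 / (n : ℝ)) * ∑ i, |X i j| * (|(cols X (supp βs) *ᵥ u) i| * |(cols X (supp βs) *ᵥ v) i|) ≤
      Q1 X βs * ((supp βs).card : ℝ) * (‖u‖ * ‖v‖) := by
  have hQ := Q1_nonneg X hs
  have hb : ∀ w : supp βs → ℝ, (1 / (n : ℝ)) * ∑ i, |X i j| * (cols X (supp βs) *ᵥ w) i ^ 2 ≤
      Q1 X βs * ((supp βs).card : ℝ) * ‖w‖ ^ 2 := fun w => by
    refine (quadForm_le_Q1 X βs j w).trans ?_
    rw [mul_assoc]
    refine mul_le_mul_of_nonneg_left ?_ hQ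
    simpa using dotProduct_self_le_card_mul w
  refine le_of_sq_le_sq ?_ (by positivity)
  have hcs := Finset.sum_sq_le_sum_mul_sum_of_sq_le_mul (Finset.univ : Finset (Fin n))
    (r := fun i => |X i j| * (|(cols X (supp βs) *ᵥ u) i| * |(cols X (supp βs) *ᵥ v) i|))
    (f := fun i => |X i j| * (cols X (supp βs) *ᵥ u) i ^ 2)
    (g := fun i => |X i j| * (cols X (supp βs) *ᵥ v) i ^ 2)
    (fun i _ => by positivity) (fun i _ => by positivity)
    (fun i _ => le_of_eq <| by
      rw [mul_pow, mul_pow, sq_abs ((cols X (supp βs) *ᵥ u) i),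
        sq_abs ((cols X (supp βs) *ᵥ v) i)]
      ring)
  calc _ = (1 / (n : ℝ)) ^ 2 * (∑ i, |X i j| *
        (|(cols X (supp βs) *ᵥ u) i| * |(cols X (supp βs) *ᵥ v) i|)) ^ 2 := by ring
    _ ≤ (1 / (n : ℝ)) ^ 2 * ((∑ i, |X i j| * (cols X (supp βs) *ᵥ u) i ^ 2) *
        ∑ i, |X i j| * (cols X (supp βs) *ᵥ v) i ^ 2) :=
      mul_le_mul_of_nonneg_left hcs (by positivity)
    _ = ((1 / (n : ℝ)) * ∑ i, |X i j| * (cols X (supp βs) *ᵥ u) i ^ 2) *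
        ((1 / (n : ℝ)) * ∑ i, |X i j| * (cols X (supp βs) *ᵥ v) i ^ 2) := by ring
    _ ≤ (Q1 X βs * ((supp βs).card : ℝ) * ‖u‖ ^ 2) * (Q1 X βs * ((supp βs).card : ℝ) * ‖v‖ ^ 2) :=
      mul_le_mul (hb u) (hb v) (by positivity) (by positivity)
    _ = _ := by ring

/-- The second-order remainder of the gradient at `βs`, for a perturbation of the support. -/
noncomputable def gradRem (X : Matrix (Fin n) (Fin p) ℝ) (βs : Fin p → ℝ) (v : supp βs → ℝ)
    (j : Fin p) : ℝ :=
  (1 / (n : ℝ)) * ∑ i, X i j * meanRem ((X *ᵥ βs) i) ((cols X (supp βs) *ᵥ v) i)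

lemma abs_gradRem_sub_le (X : Matrix (Fin n) (Fin p) ℝ) {βs : Fin p → ℝ}
    (hs : (supp βs).Nonempty) (u v : supp βs → ℝ) (j : Fin p) :
    |gradRem X βs u j - gradRem X βs v j| ≤
      1 / 4 * (Q1 X βs * ((supp βs).card : ℝ)) * ((‖u‖ + ‖v‖) * ‖u - v‖) := by
  set Z := cols X (supp βs) with hZ
  have h1 := bilinForm_le_Q1 X hs j u (u - v)
  have h2 := bilinForm_le_Q1 X hs j v (u - v)
  rw [← hZ] at h1 h2
  have h3 : |gradRem X βs u j - gradRem X βs v j| ≤ 1 / 4 *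
      ((1 / (n : ℝ)) * ∑ i, |X i j| * (|(Z *ᵥ u) i| * |(Z *ᵥ (u - v)) i|) +
      (1 / (n : ℝ)) * ∑ i, |X i j| * (|(Z *ᵥ v) i| * |(Z *ᵥ (u - v)) i|)) := by
    rw [gradRem, gradRem, ← mul_sub, ← Finset.sum_sub_distrib, abs_mul,
      abs_of_nonneg (by positivity : (0 : ℝ) ≤ 1 / (n : ℝ)), ← mul_add, ← Finset.sum_add_distrib,
      mul_left_comm, Finset.mul_sum]
    refine mul_le_mul_of_nonneg_left ((Finset.abs_sum_le_sum_abs _ _).trans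
      (Finset.sum_le_sum fun i _ => ?_)) (by positivity)
    rw [← mul_sub, abs_mul]
    have := mul_le_mul_of_nonneg_left
      (abs_meanRem_sub_le ((X *ᵥ βs) i) ((Z *ᵥ u) i) ((Z *ᵥ v) i)) (abs_nonneg (X i j))
    rw [Matrix.mulVec_sub, Pi.sub_apply]
    linarith
  linarith

lemma gradRem_zero (X : Matrix (Fin n) (Fin p) ℝ) (βs : Fin p → ℝ) (j : Fin p) :
    gradRem X βs 0 j = 0 := by
  simp [gradRem, meanRem_zero]

lemma grad_add_extendZero (X : Matrix (Fin n) (Fin p) ℝ) (y : Fin n → ℝ) (βs : Fin p → ℝ)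
    (v : supp βs → ℝ) (j : Fin p) :
    grad X y (βs + extendZero (supp βs) v) j = grad X y βs j +
      (1 / (n : ℝ)) * (∑ i, X i j * (psiTwo ((X *ᵥ βs) i) * (cols X (supp βs) *ᵥ v) i)) +
      gradRem X βs v j := by
  rw [grad, grad, gradRem, ← mul_add, ← mul_add, ← Finset.sum_add_distrib,
    ← Finset.sum_add_distrib]
  congr 1
  refine Finset.sum_congr rfl fun i _ => ?_
  rw [Matrix.mulVec_add, mulVec_extendZero, Pi.add_apply, meanRem]
  ring

lemma cols_transpose_mul_Sig_mulVec (X : Matrix (Fin n) (Fin p) ℝ) (βs : Fin p → ℝ)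
    (S : Finset (Fin p)) (v : supp βs → ℝ) (j : S) :
    (((cols X S)ᵀ * Sig X βs * cols X (supp βs)) *ᵥ v) j =
      ∑ i, X i j * (psiTwo ((X *ᵥ βs) i) * (cols X (supp βs) *ᵥ v) i) := by
  rw [Matrix.mul_assoc, ← Matrix.mulVec_mulVec, ← Matrix.mulVec_mulVec, Sig]
  change ∑ i, X i j * (Matrix.diagonal _ *ᵥ _) i = _
  simp only [Matrix.mulVec_diagonal, deriv_deriv_psi]

/-- The weights `psiTwo` are positive, so a kernel vector of the Gram matrix is killed by `cols X
(supp βs)`, which is injective. -/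
lemma isUnit_det_gram {X : Matrix (Fin n) (Fin p) ℝ} {βs : Fin p → ℝ}
    (hκ : 0 < kappaLogit X βs) :
    IsUnit ((cols X (supp βs))ᵀ * Sig X βs * cols X (supp βs)).det := by
  rw [isUnit_iff_ne_zero]
  intro hdet
  obtain ⟨v, hv, h0⟩ := Matrix.exists_mulVec_eq_zero_iff.2 hdet
  have hne : extendZero (supp βs) v ≠ 0 := fun h => hv (funext fun j => by
    have := congrFun h j
    rwa [extendZero_of_mem v j.2] at this)
  refine mulVec_ne_zero_of_kappaLogit_pos hκ (fun j hj => extendZero_of_notMem v hj) hne ?_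
  rw [mulVec_extendZero]
  have h1 : v ⬝ᵥ (((cols X (supp βs))ᵀ * Sig X βs * cols X (supp βs)) *ᵥ v) =
      ∑ i, psiTwo ((X *ᵥ βs) i) * (cols X (supp βs) *ᵥ v) i ^ 2 := by
    rw [Matrix.mul_assoc, ← Matrix.mulVec_mulVec, Matrix.dotProduct_mulVec,
      Matrix.vecMul_transpose, ← Matrix.mulVec_mulVec]
    simp only [dotProduct, Sig, Matrix.mulVec_diagonal, deriv_deriv_psi]
    exact Finset.sum_congr rfl fun i _ => by ring
  rw [h0, dotProduct_zero] at h1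
  ext i
  have := (Finset.sum_eq_zero_iff_of_nonneg fun i _ =>
    mul_nonneg (psiTwo_pos _).le (sq_nonneg _)).1 h1.symm i (Finset.mem_univ i)
  simpa [(psiTwo_pos _).ne'] using this

lemma n_pos_of_kappaLogit_pos {X : Matrix (Fin n) (Fin p) ℝ} {βs : Fin p → ℝ}
    (hκ : 0 < kappaLogit X βs) : 0 < n := by
  obtain ⟨j, hj⟩ := supp_nonempty hκ
  rcases Nat.eq_zero_or_pos n with rfl | h
  · refine absurd (Subsingleton.elim _ _) (mulVec_ne_zero_of_kappaLogit_pos hκ (d := βs)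
      (fun j hj => by simpa [supp] using hj) fun h => ?_)
    simp [supp, h] at hj
  · exact h

/-! ### Construction of the oracle estimator. -/

/-- A contraction argument: the gradient of the loss restricted to the support vanishes close to
the true coefficients. -/
theorem exists_stationary {X : Matrix (Fin n) (Fin p) ℝ} {y : Fin n → ℝ} {βs : Fin p → ℝ} {g : ℝ}
    (hκ : 0 < kappaLogit X βs) (hg0 : 0 ≤ g) (hg : ∀ j ∈ supp βs, |grad X y βs j| ≤ g)
    (hsmall : Q1 X βs * Q2 X βs ^ 2 * ((supp βs).card : ℝ) * g < 1) :
    ∃ v : supp βs → ℝ, ‖v‖ ≤ 2 * Q2 X βs * g ∧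
      ((1 / (n : ℝ)) • ((cols X (supp βs))ᵀ * Sig X βs * cols X (supp βs))) *ᵥ v =
        -fun j : supp βs => grad X y βs j + gradRem X βs v j := by
  have hs := supp_nonempty hκ
  have hQ1 := Q1_nonneg X hs
  have hQ2 : 0 ≤ Q2 X βs := linftyNorm_nonneg _
  have hn := n_pos_of_kappaLogit_pos hκ
  set H := (1 / (n : ℝ)) • ((cols X (supp βs))ᵀ * Sig X βs * cols X (supp βs)) with hH
  have hdet : IsUnit H.det := by
    rw [hH, Matrix.det_smul]
    refine IsUnit.mul (IsUnit.pow _ ?_) (isUnit_det_gram hκ)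
    rw [isUnit_iff_ne_zero]
    positivity
  set s : ℝ := ((supp βs).card : ℝ)
  set r := 2 * Q2 X βs * g with hr
  have hr0 : 0 ≤ r := by positivity
  -- A fixed point solves `H v = -(gradient + remainder)`, which says that the gradient at `βs + v`
  -- vanishes on the support.
  set Φ : (supp βs → ℝ) → (supp βs → ℝ) := fun v =>
    -(H⁻¹ *ᵥ fun j : supp βs => grad X y βs j + gradRem X βs v j) with hΦ
  have hinv : ∀ (w : supp βs → ℝ) (c : ℝ), 0 ≤ c → (∀ j, |w j| ≤ c) →
      ‖H⁻¹ *ᵥ w‖ ≤ Q2 X βs * c := fun w c hc hw => by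
    refine (pi_norm_le_iff_of_nonneg (by positivity)).2 fun j => ?_
    refine (abs_mulVec_le_linftyNorm H⁻¹ w j).trans ?_
    exact mul_le_mul_of_nonneg_left ((pi_norm_le_iff_of_nonneg hc).2 hw) hQ2
  have hmaps : Set.MapsTo Φ (Metric.closedBall 0 r) (Metric.closedBall 0 r) := by
    intro v hv
    rw [mem_closedBall_zero_iff] at hv ⊢
    rw [hΦ, norm_neg]
    refine (hinv _ (2 * g) (by positivity) fun j => ?_).trans (le_of_eq (by rw [hr]; ring))
    have h1 := abs_gradRem_sub_le X hs v 0 j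
    rw [gradRem_zero, sub_zero, norm_zero, add_zero, sub_zero] at h1
    have h2 : ‖v‖ * ‖v‖ ≤ r * r := mul_self_le_mul_self (norm_nonneg _) hv
    have h3 := mul_le_mul_of_nonneg_left h2 (show 0 ≤ 1 / 4 * (Q1 X βs * s) by positivity)
    -- On the ball the remainder is thus no larger than `g`, so the right-hand side is at most `2 *
    -- g` and `H⁻¹` maps it back into radius `2 * Q2 * g`.
    have h4 : 1 / 4 * (Q1 X βs * s) * (r * r) ≤ g := by
      calc _ = g * (Q1 X βs * Q2 X βs ^ 2 * s * g) := by rw [hr]; ring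
        _ ≤ g * 1 := mul_le_mul_of_nonneg_left hsmall.le hg0
        _ = g := mul_one g
    have h5 := abs_add_le (grad X y βs j) (gradRem X βs v j)
    linarith [hg j j.2]
  -- This is `Q2` times the Lipschitz constant `(1/4) Q1 s * 2r` of the remainder on the ball.
  set K : NNReal := ⟨Q1 X βs * Q2 X βs ^ 2 * s * g, by positivity⟩ with hK
  have hcontr : ContractingWith K (hmaps.restrict Φ (Metric.closedBall 0 r)
      (Metric.closedBall 0 r)) := by
    refine ⟨NNReal.coe_lt_coe.1 hsmall, LipschitzWith.of_dist_le_mul ?_⟩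
    rintro ⟨u, hu⟩ ⟨v, hv⟩
    rw [mem_closedBall_zero_iff] at hu hv
    rw [Subtype.dist_eq, Subtype.dist_eq, dist_eq_norm, dist_eq_norm]
    have e : Φ u - Φ v = -(H⁻¹ *ᵥ fun j : supp βs => gradRem X βs u j - gradRem X βs v j) := by
      rw [hΦ, ← neg_add', ← sub_eq_add_neg, ← Matrix.mulVec_sub]
      congr 2
      ext j
      simp
    change ‖Φ u - Φ v‖ ≤ Q1 X βs * Q2 X βs ^ 2 * s * g * ‖u - v‖
    rw [e, norm_neg]
    refine (hinv _ (1 / 4 * (Q1 X βs * s) * ((r + r) * ‖u - v‖)) (by positivity)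
      fun j => ?_).trans (le_of_eq (by rw [hr]; ring))
    refine (abs_gradRem_sub_le X hs u v j).trans ?_
    gcongr
  obtain ⟨v, hv, hfix, -⟩ := hcontr.exists_fixedPoint'
    Metric.isClosed_closedBall.isComplete hmaps (Metric.mem_closedBall_self hr0) (edist_ne_top _ _)
  refine ⟨v, mem_closedBall_zero_iff.1 hv, ?_⟩
  have : v = -(H⁻¹ *ᵥ fun j : supp βs => grad X y βs j + gradRem X βs v j) := hfix.symm
  conv_lhs => rw [this]
  rw [Matrix.mulVec_neg, Matrix.mulVec_mulVec, Matrix.mul_nonsing_inv H hdet, Matrix.one_mulVec]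

/-- Off the support, the linear part of the gradient change is the matrix of `Q3` applied to `H v`,
whose norm is at most `2 * g` by stationarity. It contributes `2 * Q3 * g`, and the remainder
contributes `g`. -/
theorem exists_oracle {X : Matrix (Fin n) (Fin p) ℝ} {y : Fin n → ℝ} {βs : Fin p → ℝ} {g : ℝ}
    (hκ : 0 < kappaLogit X βs) (hg0 : 0 ≤ g) (hg : ∀ j ∈ supp βs, |grad X y βs j| ≤ g)
    (hsmall : Q1 X βs * Q2 X βs ^ 2 * ((supp βs).card : ℝ) * g < 1) :
    ∃ bo : Fin p → ℝ, (∀ j ∉ supp βs, bo j = 0) ∧ (∀ j ∈ supp βs, grad X y bo j = 0) ∧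
      (∀ j ∈ supp βs, |bo j - βs j| ≤ 2 * Q2 X βs * g) ∧
      ∀ j ∉ supp βs, |grad X y bo j| ≤ |grad X y βs j| + (1 + 2 * Q3 X βs) * g := by
  obtain ⟨v, hv, heq⟩ := exists_stationary hκ hg0 hg hsmall
  have hs := supp_nonempty hκ
  have hQ1 := Q1_nonneg X hs
  have hQ2 : 0 ≤ Q2 X βs := linftyNorm_nonneg _
  have hQ3 : 0 ≤ Q3 X βs := linftyNorm_nonneg _
  have hrem : ∀ j, |gradRem X βs v j| ≤ g := fun j => by
    have h1 := abs_gradRem_sub_le X hs v 0 j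
    rw [gradRem_zero, sub_zero, norm_zero, add_zero, sub_zero] at h1
    have h2 := mul_le_mul_of_nonneg_left (mul_self_le_mul_self (norm_nonneg _) hv)
      (show 0 ≤ 1 / 4 * (Q1 X βs * ((supp βs).card : ℝ)) by positivity)
    nlinarith [mul_le_mul_of_nonneg_left hsmall.le hg0]
  refine ⟨βs + extendZero (supp βs) v, fun j hj => ?_, fun j hj => ?_, fun j hj => ?_,
    fun j hj => ?_⟩
  · have : βs j = 0 := by simpa [supp] using hj
    rw [Pi.add_apply, this, extendZero_of_notMem v hj, add_zero]
  · have h1 := congrFun heq ⟨j, hj⟩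
    rw [Matrix.smul_mulVec, Pi.smul_apply, cols_transpose_mul_Sig_mulVec, smul_eq_mul] at h1
    rw [grad_add_extendZero, h1]
    simp only [Pi.neg_apply]
    ring
  · rw [Pi.add_apply, add_sub_cancel_left, extendZero_of_mem v hj]
    exact (norm_le_pi_norm v ⟨j, hj⟩).trans hv
  · set Gm := (cols X (supp βs))ᵀ * Sig X βs * cols X (supp βs) with hGm
    set Cr := (cols X (supp βs)ᶜ)ᵀ * Sig X βs * cols X (supp βs) with hCr
    have hjc : j ∈ (supp βs)ᶜ := Finset.mem_compl.2 hj
    have h1 : (1 / (n : ℝ)) * (∑ i, X i j * (psiTwo ((X *ᵥ βs) i) * (cols X (supp βs) *ᵥ v) i))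
        = ((Cr * Gm⁻¹) *ᵥ (((1 / (n : ℝ)) • Gm) *ᵥ v)) ⟨j, hjc⟩ := by
      rw [← cols_transpose_mul_Sig_mulVec X βs (supp βs)ᶜ v ⟨j, hjc⟩, ← hCr, Matrix.smul_mulVec,
        Matrix.mulVec_smul, Matrix.mulVec_mulVec, Matrix.mul_assoc,
        Matrix.nonsing_inv_mul Gm (isUnit_det_gram hκ), Matrix.mul_one]
      rfl
    have h2 : ‖((1 / (n : ℝ)) • Gm) *ᵥ v‖ ≤ 2 * g := by
      rw [heq, norm_neg]
      refine (pi_norm_le_iff_of_nonneg (by positivity)).2 fun k => ?_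
      have := abs_add_le (grad X y βs k) (gradRem X βs v k)
      rw [Real.norm_eq_abs]
      linarith [hg k k.2, hrem k]
    have h3 := (abs_mulVec_le_linftyNorm (Cr * Gm⁻¹) (((1 / (n : ℝ)) • Gm) *ᵥ v)
      ⟨j, hjc⟩).trans (mul_le_mul_of_nonneg_left h2 (linftyNorm_nonneg _))
    have h4 : linftyNorm (Cr * Gm⁻¹) = Q3 X βs := rfl
    rw [h4] at h3
    rw [grad_add_extendZero, h1]
    refine (abs_add_le _ _).trans ?_
    linarith [abs_add_le (grad X y βs j)
      (((Cr * Gm⁻¹) *ᵥ (((1 / (n : ℝ)) • Gm) *ᵥ v)) ⟨j, hjc⟩), hrem j]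

/-! ### From gradient thresholds to the LLA conclusion. -/

lemma mul_lt_one_of_lt_one_div {a x : ℝ} (ha : 0 ≤ a) (h : x < 1 / a) : a * x < 1 := by
  rcases ha.eq_or_lt with rfl | ha
  · simp
  · rw [lt_div_iff₀ ha] at h
    linarith

lemma mul_lt_of_lt_div {a b x : ℝ} (ha : 0 ≤ a) (hx : 0 ≤ x) (h : x < b / a) : a * x < b := by
  rcases ha.eq_or_lt with rfl | ha
  · rw [div_zero] at h
    exact absurd h (not_lt.2 hx)
  · rw [lt_div_iff₀ ha] at h
    linarith

/-- The algorithm reaches the oracle estimator when the gradient at the true coefficients is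
small. -/
theorem llaReachesOracle_of_grad_lt {X : Matrix (Fin n) (Fin p) ℝ} {y : Fin n → ℝ}
    {βs : Fin p → ℝ} {P : ℝ → ℝ} {lam lamLasso a₁ a₂ a : ℝ}
    (hP : IsFoldedConcave P lam a₁ a₂ a) (hA0 : (a + 1) * lam < minSignal βs)
    (hκ : 0 < kappaLogit X βs) (hl : 0 < lamLasso)
    (hlasso : lamLasso ≤ kappaLogit X βs / (20 * maxEntry X * ((supp βs).card : ℝ)))
    (hlam : 5 * Real.sqrt ((supp βs).card : ℝ) * lamLasso / (min 1 a₂ * kappaLogit X βs) ≤ lam)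
    (hy : ∀ i, 0 ≤ y i ∧ y i ≤ 1)
    (h0 : ∀ j, |grad X y βs j| < lamLasso / 2)
    (h1 : ∀ j ∈ supp βs, |grad X y βs j| < min (1 / (Q1 X βs * Q2 X βs ^ 2 * (supp βs).card))
      (a₁ * lam / (2 * (1 + 2 * Q3 X βs))))
    (h2 : ∀ j ∈ (supp βs)ᶜ, |grad X y βs j| < a₁ * lam / 2)
    (h3 : ∀ j ∈ supp βs, |grad X y βs j| < min (1 / (Q1 X βs * Q2 X βs ^ 2 * (supp βs).card))
      ((minSignal βs - a * lam) / (2 * Q2 X βs))) :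
    LLAReachesOracle X βs P lamLasso y := by
  have hs := supp_nonempty hκ
  have hQ1 := Q1_nonneg X hs
  have hQ2 : 0 ≤ Q2 X βs := linftyNorm_nonneg _
  have hQ3 : 0 ≤ Q3 X βs := linftyNorm_nonneg _
  have hlam0 : 0 < lam := by
    refine lt_of_lt_of_le ?_ hlam
    have : (0 : ℝ) < (supp βs).card := Nat.cast_pos.2 hs.card_pos
    have : 0 < min 1 a₂ := lt_min one_pos hP.a₂_pos
    positivity
  -- Taking for `g` the largest gradient entry on the support makes all strict thresholds apply to
  -- the same `g`.
  obtain ⟨k, hk, hmax⟩ := Finset.exists_max_image (supp βs) (fun j => |grad X y βs j|) hs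
  obtain ⟨k1, k2⟩ := lt_min_iff.1 (h1 k hk)
  have k3 := (lt_min_iff.1 (h3 k hk)).2
  obtain ⟨bo, hbo, hgA, hclose, hgAc⟩ := exists_oracle hκ (abs_nonneg (grad X y βs k)) hmax
    (mul_lt_one_of_lt_one_div (by positivity) k1)
  refine llaReachesOracle_of_bounds hP hlam0 hA0 hκ hbo hgA (fun j hj => ?_) (fun j hj => ?_)
    (exists_isLasso X hy hl)
    fun b hb => abs_sub_le_of_isLasso hl hκ hP.a₂_pos hlasso hlam (fun j => (h0 j).le) hb
  · have e1 := mul_lt_of_lt_div (by positivity) (abs_nonneg _) k2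
    linarith [hgAc j hj, h2 j (Finset.mem_compl.2 hj)]
  · have e1 := mul_lt_of_lt_div (by positivity) (abs_nonneg _) k3
    have e2 := abs_sub_abs_le_abs_sub (βs j) (bo j)
    rw [abs_sub_comm] at e2
    linarith [hclose j hj, minSignal_le hj]

/-! ### Concentration of the gradient. -/

variable {Ω : Type*} [MeasurableSpace Ω] {μ : Measure Ω}

lemma IsLogisticModel.ae_zero_or_one {X : Matrix (Fin n) (Fin p) ℝ} {βs : Fin p → ℝ}
    {y : Fin n → Ω → ℝ} (h : IsLogisticModel μ X βs y) :
    ∀ᵐ ω ∂μ, ∀ i, y i ω = 0 ∨ y i ω = 1 := by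
  refine ae_all_iff.2 fun i => ?_
  have hm : MeasurableSet {x : ℝ | x = 0 ∨ x = 1} :=
    (measurableSet_singleton 0).union (measurableSet_singleton 1)
  rw [(h.law i).ae_iff (p := fun x => x = 0 ∨ x = 1) (measurableSet_setOfPred.1 hm),
    bernoulliMeasure_def, ae_add_measure_iff]
  constructor
  · refine Measure.ae_smul_measure ?_ _
    rw [ae_dirac_iff hm]
    exact Or.inr rfl
  · refine Measure.ae_smul_measure ?_ _
    rw [ae_dirac_iff hm]
    exact Or.inl rfl

lemma IsLogisticModel.integral_eq {X : Matrix (Fin n) (Fin p) ℝ} {βs : Fin p → ℝ}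
    {y : Fin n → Ω → ℝ} (h : IsLogisticModel μ X βs y) (i : Fin n) :
    ∫ ω, y i ω ∂μ = Real.sigmoid ((X *ᵥ βs) i) := by
  rw [(h.law i).integral_eq, integral_bernoulliMeasure, ← exp_div_one_add_exp]
  simp [successProb]

lemma hasSubgaussianMGF_mono {Y : Ω → ℝ} {c d : NNReal} (h : HasSubgaussianMGF Y c μ)
    (hcd : c ≤ d) : HasSubgaussianMGF Y d μ where
  integrable_exp_mul := h.integrable_exp_mul
  mgf_le t := (h.mgf_le t).trans <| Real.exp_le_exp.2 <| by
    have : (c : ℝ) ≤ d := hcd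
    gcongr

lemma colM_nonneg (X : Matrix (Fin n) (Fin p) ℝ) : 0 ≤ colM X :=
  Real.iSup_nonneg fun _ => by positivity

/-- By Hoeffding's lemma a centred `[0, 1]`-valued response has parameter `1/4`. The gradient is
their independent sum with weights `-(X i j / n)`, so the parameters add up to `∑ X i j ^ 2 / (4 n ^
2)`. -/
lemma IsLogisticModel.hasSubgaussianMGF_grad [IsProbabilityMeasure μ]
    {X : Matrix (Fin n) (Fin p) ℝ} {βs : Fin p → ℝ} {y : Fin n → Ω → ℝ}
    (h : IsLogisticModel μ X βs y) (j : Fin p) :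
    HasSubgaussianMGF (fun ω => grad X (fun i => y i ω) βs j)
      ⟨colM X / (4 * n), div_nonneg (colM_nonneg X) (by positivity)⟩ μ := by
  have h1 : ∀ i, HasSubgaussianMGF (fun ω => -(X i j / n) * (y i ω - ∫ ω', y i ω' ∂μ)) _ μ := fun i =>
    (hasSubgaussianMGF_of_mem_Icc (a := 0) (b := 1) (h.law i).aemeasurable (by
      filter_upwards [h.ae_zero_or_one] with ω hω
      rcases hω i with h | h <;> simp [h])).const_mul (-(X i j / n))
  have hind : iIndepFun (fun i ω => -(X i j / n) * (y i ω - ∫ ω', y i ω' ∂μ)) μ :=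
    h.indep.comp (fun i x => -(X i j / n) * (x - ∫ ω', y i ω' ∂μ)) fun i => by fun_prop
  have h2 := HasSubgaussianMGF.sum_of_iIndepFun hind (s := Finset.univ) fun i _ => h1 i
  have e : (fun ω => ∑ i, -(X i j / n) * (y i ω - ∫ ω', y i ω' ∂μ)) =
      fun ω => grad X (fun i => y i ω) βs j := by
    funext ω
    rw [grad, Finset.mul_sum]
    refine Finset.sum_congr rfl fun i _ => ?_
    rw [h.integral_eq i]
    ring
  rw [e] at h2
  refine hasSubgaussianMGF_mono h2 (NNReal.coe_le_coe.1 ?_)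
  have hM : (1 / (n : ℝ)) * ∑ i, X i j ^ 2 ≤ colM X :=
    le_ciSup (f := fun j => (1 / (n : ℝ)) * ∑ i, X i j ^ 2) (Set.finite_range _).bddAbove j
  have hM' := mul_le_mul_of_nonneg_right hM (show 0 ≤ 1 / (4 * (n : ℝ)) by positivity)
  push_cast
  refine le_trans (le_of_eq ?_) (hM'.trans (le_of_eq ?_))
  · rw [Finset.mul_sum, Finset.sum_mul]
    refine Finset.sum_congr rfl fun i _ => ?_
    change (-(X i j / n)) ^ 2 * (‖(1 : ℝ) - 0‖ / 2) ^ 2 = _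
    norm_num
    ring
  · change colM X * (1 / (4 * (n : ℝ))) = colM X / (4 * n)
    ring

lemma IsLogisticModel.measureReal_le_abs_grad [IsProbabilityMeasure μ]
    {X : Matrix (Fin n) (Fin p) ℝ} {βs : Fin p → ℝ} {y : Fin n → Ω → ℝ}
    (h : IsLogisticModel μ X βs y) (j : Fin p) {ε : ℝ} (hε : 0 ≤ ε) :
    μ.real {ω | ε ≤ |grad X (fun i => y i ω) βs j|} ≤
      2 * Real.exp (-(n / colM X * (2 * ε ^ 2))) := by
  have hg := h.hasSubgaussianMGF_grad j
  -- This holds even if `n` or `colM X` is zero: both sides are then `0`.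
  have e : -ε ^ 2 / (2 * (colM X / (4 * n))) = -(n / colM X * (2 * ε ^ 2)) := by
    simp only [div_eq_mul_inv, mul_inv, inv_inv]
    ring
  have h1 : _ ≤ Real.exp (-ε ^ 2 / (2 * (colM X / (4 * n)))) := hg.measure_ge_le hε
  have h2 : _ ≤ Real.exp (-ε ^ 2 / (2 * (colM X / (4 * n)))) := hg.neg.measure_ge_le hε
  rw [e] at h1 h2
  have hsub : {ω | ε ≤ |grad X (fun i => y i ω) βs j|} ⊆
      {ω | ε ≤ grad X (fun i => y i ω) βs j} ∪
        {ω | ε ≤ (-fun ω => grad X (fun i => y i ω) βs j) ω} := by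
    intro ω hω
    have h : ε ≤ |grad X (fun i => y i ω) βs j| := hω
    exact le_abs.1 h
  have h3 := (measureReal_mono (μ := μ) hsub).trans (measureReal_union_le _ _)
  linarith

lemma IsLogisticModel.measureReal_biUnion_le [IsProbabilityMeasure μ]
    {X : Matrix (Fin n) (Fin p) ℝ} {βs : Fin p → ℝ} {y : Fin n → Ω → ℝ}
    (h : IsLogisticModel μ X βs y) (S : Finset (Fin p)) {ε : ℝ} (hε : 0 ≤ ε) :
    μ.real (⋃ j ∈ S, {ω | ε ≤ |grad X (fun i => y i ω) βs j|}) ≤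
      2 * (S.card : ℝ) * Real.exp (-(n / colM X * (2 * ε ^ 2))) := by
  refine (measureReal_biUnion_finset_le _ _).trans ?_
  refine (Finset.sum_le_card_nsmul S _ _ fun j _ => h.measureReal_le_abs_grad j hε).trans
    (le_of_eq ?_)
  rw [nsmul_eq_mul]
  ring

/-- Any property of the responses is an event up to a null set, since almost surely there are only
finitely many possible responses. -/
lemma IsLogisticModel.nullMeasurableSet {X : Matrix (Fin n) (Fin p) ℝ} {βs : Fin p → ℝ}
    {y : Fin n → Ω → ℝ} (h : IsLogisticModel μ X βs y) (q : (Fin n → ℝ) → Prop) :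
    NullMeasurableSet {ω | q fun i => y i ω} μ := by
  have hfin : {z : Fin n → ℝ | q z ∧ ∀ i, z i = 0 ∨ z i = 1}.Finite := by
    refine Set.Finite.subset (Set.Finite.pi' (t := fun _ : Fin n => ({0, 1} : Set ℝ))
      fun _ => Set.toFinite _) ?_
    rintro z ⟨-, hz⟩ i
    exact hz i
  have hm : AEMeasurable (fun ω i => y i ω) μ := aemeasurable_pi_lambda _ fun i =>
    (h.law i).aemeasurable
  refine (hm.nullMeasurableSet_preimage hfin.measurableSet).congr ?_
  filter_upwards [h.ae_zero_or_one] with ω hω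
  exact propext ⟨fun hz => hz.1, fun hz => ⟨hz, hω⟩⟩

lemma min_le_two_mul_min_sq {a b c d : ℝ} (hc : c = 2 * a ^ 2) (hd : d = 2 * b ^ 2) :
    min c d ≤ 2 * min a b ^ 2 := by
  rcases min_choice a b with h | h <;> rw [h]
  · exact (min_le_left _ _).trans hc.le
  · exact (min_le_right _ _).trans hd.le

end FoldedConcave

/-! ### The probability bound. -/

open FoldedConcave

theorem corollary5 {n p : ℕ} {Ω : Type*} [MeasurableSpace Ω] (μ : Measure Ω)
    [IsProbabilityMeasure μ]
    (X : Matrix (Fin n) (Fin p) ℝ) (βs : Fin p → ℝ) (y : Fin n → Ω → ℝ)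
    (P : ℝ → ℝ) (lam lamLasso a₁ a₂ a : ℝ)
    (hP : FoldedConcave.IsFoldedConcave P lam a₁ a₂ a)
    (hA0 : (a + 1) * lam < FoldedConcave.minSignal βs)
    (hA2 : FoldedConcave.IsLogisticModel μ X βs y)
    (hC2 : 0 < FoldedConcave.kappaLogit X βs)
    (hlasso_pos : 0 < lamLasso)
    (hlasso : lamLasso ≤ FoldedConcave.kappaLogit X βs /
      (20 * FoldedConcave.maxEntry X * ((FoldedConcave.supp βs).card : ℝ)))
    (hlam : 5 * Real.sqrt ((FoldedConcave.supp βs).card : ℝ) * lamLasso /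
      (min 1 a₂ * FoldedConcave.kappaLogit X βs) ≤ lam) :
    NullMeasurableSet
        {ω | FoldedConcave.LLAReachesOracle X βs P lamLasso fun i => y i ω} μ ∧
      1 - 2 * (p : ℝ) * Real.exp (-((n : ℝ) / (2 * FoldedConcave.colM X) * lamLasso ^ 2)) -
          FoldedConcave.delta1 X βs lam a₁ - FoldedConcave.delta2 X βs lam a ≤
        μ.real {ω | FoldedConcave.LLAReachesOracle X βs P lamLasso fun i => y i ω} := by
  have hs := supp_nonempty hC2
  have hQ1 := Q1_nonneg X hs
  have hQ2 : 0 ≤ Q2 X βs := linftyNorm_nonneg _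
  have hQ3 : 0 ≤ Q3 X βs := linftyNorm_nonneg _
  have hM := colM_nonneg X
  have hlam0 : 0 < lam := by
    refine lt_of_lt_of_le ?_ hlam
    have : (0 : ℝ) < (supp βs).card := Nat.cast_pos.2 hs.card_pos
    have : 0 < min 1 a₂ := lt_min one_pos hP.a₂_pos
    positivity
  have ha₁ := hP.a₁_pos
  have hgap : 0 ≤ minSignal βs - a * lam := by linarith
  refine ⟨hA2.nullMeasurableSet _, ?_⟩
  set G : Set Ω := {ω | LLAReachesOracle X βs P lamLasso fun i => y i ω}
  set ε₁ := min (1 / (Q1 X βs * Q2 X βs ^ 2 * (supp βs).card))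
    (a₁ * lam / (2 * (1 + 2 * Q3 X βs))) with hε₁
  set ε₂ := min (1 / (Q1 X βs * Q2 X βs ^ 2 * (supp βs).card))
    ((minSignal βs - a * lam) / (2 * Q2 X βs)) with hε₂
  set U : Finset (Fin p) → ℝ → Set Ω := fun S ε =>
    ⋃ j ∈ S, {ω | ε ≤ |grad X (fun i => y i ω) βs j|} with hU
  -- The inclusion is only almost sure, since the deterministic result needs responses in `[0, 1]`.
  have hcover : ∀ᵐ ω ∂μ, ω ∈ (Set.univ : Set Ω) → ω ∈ G ∪ (U Finset.univ (lamLasso / 2) ∪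
      (U (supp βs) ε₁ ∪ (U (supp βs)ᶜ (a₁ * lam / 2) ∪ U (supp βs) ε₂))) := by
    filter_upwards [hA2.ae_zero_or_one] with ω hω _
    by_contra hnot
    simp only [Set.mem_union, not_or, hU, Set.mem_iUnion, not_exists, Set.mem_ofPred_eq,
      not_le] at hnot
    obtain ⟨hG, h0, h1, h2, h3⟩ := hnot
    refine hG (llaReachesOracle_of_grad_lt hP hA0 hC2 hlasso_pos hlasso hlam (fun i => ?_)
      (fun j => h0 j (Finset.mem_univ j)) h1 h2 h3)
    rcases hω i with h | h <;> simp [h]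
  have hle : (1 : ℝ) ≤ μ.real G + (μ.real (U Finset.univ (lamLasso / 2)) +
      (μ.real (U (supp βs) ε₁) + (μ.real (U (supp βs)ᶜ (a₁ * lam / 2)) +
        μ.real (U (supp βs) ε₂)))) := by
    rw [← probReal_univ (μ := μ)]
    refine (ENNReal.toReal_mono (measure_ne_top _ _) (measure_mono_ae hcover)).trans ?_
    refine (measureReal_union_le _ _).trans (add_le_add le_rfl ?_)
    refine (measureReal_union_le _ _).trans (add_le_add le_rfl ?_)
    refine (measureReal_union_le _ _).trans (add_le_add le_rfl ?_)
    exact measureReal_union_le _ _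
  have b0 := hA2.measureReal_biUnion_le Finset.univ (ε := lamLasso / 2) (by positivity)
  have b1 := hA2.measureReal_biUnion_le (supp βs) (ε := ε₁) (le_min (by positivity) (by positivity))
  have b2 := hA2.measureReal_biUnion_le (supp βs)ᶜ (ε := a₁ * lam / 2) (by positivity)
  have b3 := hA2.measureReal_biUnion_le (supp βs) (ε := ε₂) (le_min (by positivity) (by positivity))
  have e0 : (n : ℝ) / colM X * (2 * (lamLasso / 2) ^ 2) = n / (2 * colM X) * lamLasso ^ 2 := by
    ring
  have e2 : (n : ℝ) / colM X * (2 * (a₁ * lam / 2) ^ 2) = a₁ ^ 2 * n * lam ^ 2 / (2 * colM X) := by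
    ring
  have c2 : (((supp βs)ᶜ.card : ℕ) : ℝ) = (p : ℝ) - (supp βs).card := by
    rw [Finset.card_compl, Fintype.card_fin, Nat.cast_sub]
    simpa using Finset.card_le_univ (supp βs)
  rw [e0, Finset.card_univ, Fintype.card_fin] at b0
  rw [e2, c2] at b2
  have d1 : Real.exp (-(n / colM X * (2 * ε₁ ^ 2))) ≤ Real.exp (-((n : ℝ) / colM X *
      min (2 / (Q1 X βs ^ 2 * Q2 X βs ^ 4 * ((supp βs).card : ℝ) ^ 2))
        (a₁ ^ 2 * lam ^ 2 / (2 * (1 + 2 * Q3 X βs) ^ 2)))) := by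
    refine Real.exp_le_exp.2 (neg_le_neg (mul_le_mul_of_nonneg_left ?_ (by positivity)))
    refine min_le_two_mul_min_sq ?_ ?_
    · simp only [div_eq_mul_inv, mul_inv, mul_pow, inv_pow, one_pow]
      ring
    · simp only [div_eq_mul_inv, mul_inv, mul_pow, inv_pow]
      ring
  have d3 : Real.exp (-(n / colM X * (2 * ε₂ ^ 2))) ≤
      Real.exp (-((n : ℝ) / (colM X * Q2 X βs ^ 2) *
      min (2 / (Q1 X βs ^ 2 * Q2 X βs ^ 2 * ((supp βs).card : ℝ) ^ 2))
        (1 / 2 * (minSignal βs - a * lam) ^ 2))) := by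
    -- The factor `(Q2 ^ 2)⁻¹` moves inside the minimum so that its two entries become twice the
    -- squares of the two thresholds in `ε₂`.
    have e : (n : ℝ) / (colM X * Q2 X βs ^ 2) *
        min (2 / (Q1 X βs ^ 2 * Q2 X βs ^ 2 * ((supp βs).card : ℝ) ^ 2))
          (1 / 2 * (minSignal βs - a * lam) ^ 2) =
        n / colM X * min ((Q2 X βs ^ 2)⁻¹ * (2 / (Q1 X βs ^ 2 * Q2 X βs ^ 2 *
          ((supp βs).card : ℝ) ^ 2)))
          ((Q2 X βs ^ 2)⁻¹ * (1 / 2 * (minSignal βs - a * lam) ^ 2)) := by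
      rw [← mul_min_of_nonneg _ _ (by positivity), div_mul_eq_div_div]
      ring
    rw [e]
    refine Real.exp_le_exp.2 (neg_le_neg (mul_le_mul_of_nonneg_left ?_ (by positivity)))
    refine min_le_two_mul_min_sq ?_ ?_
    · simp only [div_eq_mul_inv, mul_inv, mul_pow, inv_pow, one_pow]
      ring
    · simp only [div_eq_mul_inv, mul_inv, mul_pow, inv_pow]
      ring
  have d1' := mul_le_mul_of_nonneg_left d1 (show 0 ≤ 2 * ((supp βs).card : ℝ) by positivity)
  have d3' := mul_le_mul_of_nonneg_left d3 (show 0 ≤ 2 * ((supp βs).card : ℝ) by positivity)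
  rw [delta1, delta2]
  linarith
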